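/- For probability measures $P,Q$ on $\mathbb{R}$ let $d_{\mathrm{TV}}(P,Q)=\sup_{A}|P(A)-Q(A)|$, the supremum over all Borel sets $A\subset\mathbb{R}$, and $d_{\mathrm{loc}}(P,Q)=\sup_{x\in\mathbb{R}}|P([x,x+1))-Q([x,x+1))|$. Write $\mathcal{L}(X)$ for the law of $X$, $\mathrm{Bi}(n,p)$ for the binomial distribution, $\delta_s$ for the unit mass at $s$, $*$ for convolution, and $(x)_+=\max\{x,0\}$. Let $J$ be a finite set, let $\{\xi_i,\ i\in J\}$ be independent integer-valued random variables with finite variances $\sigma_i^2=\operatorname{Var}\xi_i$ (their expectations need not be zero), and let $W=\sum_{i\in J}\xi_i$, $\mu=\mathbb{E}W$, $\sigma^2=\operatorname{Var}W$ with $\sigma=\sqrt{\sigma^2}$. Put $$v_i=\min\{1/2,\ 1-d_{\mathrm{TV}}(\mathcal{L}(\xi_i),\mathcal{L}(\xi_i+1))\},\qquad V=\sum_{i\in J}v_i,\qquad v^*=\max_{i\in J}v_i,\qquad s=\Big\lceil \mu-\tfrac12\lceil 4\sigma^2\rceil\Big\rceil .$$ If $\sigma^2>1$, then $$d_{\mathrm{TV}}\big(\mathcal{L}(W),\mathrm{Bi}(\lceil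 4\sigma^2\rceil,1/2)*\delta_s\big)\le\frac{2\sum_{i\in J}\big(\sigma_i^3+\frac12\mathbb{E}|\xi_i|^3\big)}{\sigma^2(V-v^*)^{1/2}}+\frac{1+2.25\,\sigma^{-1}+0.25\,\sigma^{-2}}{\sigma},$$ $$d_{\mathrm{loc}}\big(\mathcal{L}(W),\mathrm{Bi}(\lceil 4\sigma^2\rceil,1/2)*\delta_s\big)\le\frac{8\sum_{i\in J}\big(\sigma_i^3+\frac12\mathbb{E}|\xi_i|^3\big)}{\sigma^2(V-4v^*)_+}+\frac{3.25+0.25\,\sigma^{-1}}{\sigma^2}.$$ Here a right-hand side is $+\infty$ if its denominator vanishes or some $\mathbb{E}|\xi_i|^3$ is infinite. -/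

import Mathlib

open MeasureTheory ProbabilityTheory
open scoped ENNReal

noncomputable section

/-- The total variation distance of two probability measures on the real line: the supremum of
`|μ A - ν A|` over all (measurable) sets `A`. -/
def dTV (μ ν : Measure ℝ) : ℝ :=
  ⨆ A : {A : Set ℝ // MeasurableSet A}, |μ.real A - ν.real A|

/-- The local limit distance of two probability measures on the real line: the supremum of
`|μ [x, x + 1) - ν [x, x + 1)|` over all real `x`. -/
def dLoc (μ ν : Measure ℝ) : ℝ :=
  ⨆ x : ℝ, |μ.real (Set.Ico x (x + 1)) - ν.real (Set.Ico x (x + 1))|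

/-- The law of an integer-valued random variable, as a measure on the real line. -/
def intLaw {Ω : Type*} [MeasurableSpace Ω] (P : Measure Ω) (X : Ω → ℤ) : Measure ℝ :=
  P.map (fun ω => (X ω : ℝ))

/-- The number `v = min {1/2, 1 - d_TV(L(X), L(X + 1))}`. -/
def smoothness {Ω : Type*} [MeasurableSpace Ω] (P : Measure Ω) (X : Ω → ℤ) : ℝ :=
  min (1 / 2) (1 - dTV (intLaw P X) (intLaw P (fun ω => X ω + 1)))

/-- The number `σ³ + (1/2) E|X|³`, where `σ² = Var X`, with value `∞` if the third absolute
moment of `X` is infinite. -/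
def thirdMomentTerm {Ω : Type*} [MeasurableSpace Ω] (P : Measure Ω) (X : Ω → ℤ) : ℝ≥0∞ :=
  ENNReal.ofReal (√(variance (fun ω => (X ω : ℝ)) P) ^ 3)
    + (1 / 2) * ∫⁻ ω, ‖(X ω : ℝ)‖ₑ ^ 3 ∂P

/-- The symmetric binomial distribution `Bi(n, 1/2)` shifted by the integer `s`, that is
`Bi(n, 1/2) * δ_s`, as a measure on the real line. -/
def shiftedSymmBinomial (n : ℕ) (s : ℤ) : Measure ℝ :=
  ((binomial n ⟨1 / 2, by norm_num, by norm_num⟩).map (Nat.cast : ℕ → ℝ)) ∗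
    Measure.dirac (s : ℝ)

end

/-! This is Stein's method for the centred binomial law. Write Δg(k) = g(k+1) - g(k) and Θg(k) =
(g(k) + g(k+1))/2. For Z with law Bi(n, 1/2) and a set B, the solution g of the Stein equation
satisfies 1_B(k) - P(Z ∈ B) = (n/4) Δg(k) - (k - n/2) Θg(k) on {0, …, n}. Put k = W - s. Since n/4
is within 1/4 of σ² and s + n/2 within 1 of μ, the error is, up to rounding terms of size ‖g‖ and
‖Δg‖/4 and a Chebyshev term for W - s outside {0, …, n}, the difference E(W - μ)Θg(W - s) - σ² EΔg(W
- s).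

Three ingredients bound it.

The solution: monotone Mills ratios give ‖Δg‖ ≤ 4/(n+1) for every B, and the same bound for ‖g‖ when
B is a point; in general ‖g‖ ≤ 2/√(n+1) (`abs_steinSol_succ_sub_le`,
`abs_steinSol_le_of_subsingleton`, `abs_steinSol_le`).

One summand: conditioning on the other summands leaves functions γ and φ of ξ_i with Δγ = Θφ and
|Δφ| ≤ A, where A bounds E Δ²g(y + W - ξ_i) uniformly in y. Comparison with the primitive x|x|/2 of
|x|, together with nonnegativity of the covariance of ξ_i and a monotone function of it, bounds the
remainder by A(σ_i³ + E|ξ_i|³/2) (`abs_stein_remainder_le`, `moment_inequality`).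

Smoothness: by Mineka's decomposition ξ_j contains a fair coin with probability u_j ≥ v_j, so W -
ξ_i contains a binomial variable with a random number K of coins. Averaging over N coins turns a
difference of a bounded f into a bound of the form a + b/(N+1), and E 1/(K+1) ≤ 1/∑ u_j. Hence A ≤
2‖Δg‖/√U and A ≤ 8‖g‖/U whenever 0 < U ≤ ∑_{j≠i} u_j (`abs_integral_zdiff_le`,
`abs_integral_zdiff_zdiff_le`); the first serves total variation, the second the local distance. -/

/-- The weight of `k` under the symmetric binomial distribution `Bi(n, 1/2)`. -/
noncomputable def symmBinomWeight (n k : ℕ) : ℝ := (n.choose k : ℝ) / 2 ^ n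

/-- The probability that a `Bi(n, 1/2)` variable is smaller than `k`. -/
noncomputable def symmBinomCdf (n k : ℕ) : ℝ := ∑ i ∈ Finset.range k, symmBinomWeight n i

/-! ### Tails and the Stein equation of the symmetric binomial law. -/

namespace SymmBinom

variable {n k : ℕ}

theorem weight_nonneg (n k : ℕ) : 0 ≤ symmBinomWeight n k := by
  unfold symmBinomWeight; positivity

theorem weight_pos (h : k ≤ n) : 0 < symmBinomWeight n k := by
  have := Nat.choose_pos h
  unfold symmBinomWeight; positivity

theorem weight_eq_zero (h : n < k) : symmBinomWeight n k = 0 := by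
  simp [symmBinomWeight, Nat.choose_eq_zero_of_lt h]

theorem weight_succ (n k : ℕ) :
    ((k : ℝ) + 1) * symmBinomWeight n (k + 1) = ((n : ℝ) - k) * symmBinomWeight n k := by
  rcases le_or_gt k n with h | h
  · have := Nat.choose_succ_right_eq n k
    have h2 : (n.choose (k + 1) : ℝ) * (k + 1) = n.choose k * (n - k) := by
      rw [← Nat.cast_sub h]; exact_mod_cast this
    unfold symmBinomWeight
    field_simp
    linarith
  · simp [weight_eq_zero h, weight_eq_zero (h.trans (Nat.lt_succ_self k))]

theorem cdf_zero (n : ℕ) : symmBinomCdf n 0 = 0 := by simp [symmBinomCdf]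

theorem cdf_succ (n k : ℕ) : symmBinomCdf n (k + 1) = symmBinomCdf n k + symmBinomWeight n k := by
  simp [symmBinomCdf, Finset.sum_range_succ]

theorem cdf_top (n : ℕ) : symmBinomCdf n (n + 1) = 1 := by
  have := Nat.sum_range_choose n
  simp only [symmBinomCdf, symmBinomWeight, ← Finset.sum_div]
  rw [← Nat.cast_sum, this]
  simp

theorem cdf_nonneg (n k : ℕ) : 0 ≤ symmBinomCdf n k :=
  Finset.sum_nonneg fun i _ => weight_nonneg n i

theorem cdf_mono (n : ℕ) : Monotone (symmBinomCdf n) :=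
  monotone_nat_of_le_succ fun k => by rw [cdf_succ]; linarith [weight_nonneg n k]

theorem cdf_le_one (h : k ≤ n + 1) : symmBinomCdf n k ≤ 1 :=
  (cdf_mono n h).trans_eq (cdf_top n)

/-- The partial first moments of the centred symmetric binomial distribution. -/
theorem sum_centered (n k : ℕ) :
    ∑ i ∈ Finset.range k, ((n : ℝ) - 2 * i) * symmBinomWeight n i = k * symmBinomWeight n k := by
  induction k with
  | zero => simp
  | succ k ih =>
    rw [Finset.sum_range_succ, ih]
    push_cast
    rw [weight_succ]; ring

/-- In `sum_centered` every index i < k has n - 2i ≥ n + 2 - 2k. -/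
theorem lower_tail (n k : ℕ) :
    ((n : ℝ) + 2 - 2 * k) * symmBinomCdf n k ≤ k * symmBinomWeight n k := by
  rw [← sum_centered, symmBinomCdf, Finset.mul_sum]
  refine Finset.sum_le_sum fun i hi => mul_le_mul_of_nonneg_right ?_ (weight_nonneg n i)
  have : (i : ℝ) + 1 ≤ k := by exact_mod_cast Finset.mem_range.1 hi
  linarith

/-- The full centred sum vanishes, so the sum over i ≥ k of (2i - n) w_i also equals k w_k, and
there 2i - n ≥ 2k - n. -/
theorem upper_tail (h : k ≤ n + 1) :
    (2 * (k : ℝ) - n) * (1 - symmBinomCdf n k) ≤ k * symmBinomWeight n k := by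
  have h1 : 1 - symmBinomCdf n k = ∑ i ∈ Finset.Ico k (n + 1), symmBinomWeight n i := by
    rw [← cdf_top n, symmBinomCdf, symmBinomCdf, Finset.sum_Ico_eq_sub _ h]
  have h2 : (k : ℝ) * symmBinomWeight n k
      = ∑ i ∈ Finset.Ico k (n + 1), (2 * (i : ℝ) - n) * symmBinomWeight n i := by
    have := Finset.sum_Ico_eq_sub (fun i : ℕ => ((n : ℝ) - 2 * i) * symmBinomWeight n i) h
    rw [sum_centered, sum_centered, weight_eq_zero (Nat.lt_succ_self n)] at this
    have h3 : ∑ i ∈ Finset.Ico k (n + 1), (2 * (i : ℝ) - n) * symmBinomWeight n i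
        = - ∑ i ∈ Finset.Ico k (n + 1), ((n : ℝ) - 2 * i) * symmBinomWeight n i := by
      rw [← Finset.sum_neg_distrib]
      exact Finset.sum_congr rfl fun i _ => by ring
    rw [h3, this]; simp
  rw [h1, h2, Finset.mul_sum]
  refine Finset.sum_le_sum fun i hi => mul_le_mul_of_nonneg_right ?_ (weight_nonneg n i)
  have : (k : ℝ) ≤ i := by exact_mod_cast (Finset.mem_Ico.1 hi).1
  linarith

/-- The lower Mills ratio `P(Z < k) / (k P(Z = k))`. -/
noncomputable def lowerMills (n k : ℕ) : ℝ := symmBinomCdf n k / (k * symmBinomWeight n k)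

/-- The upper Mills ratio `P(Z ≥ k) / (k P(Z = k))`. -/
noncomputable def upperMills (n k : ℕ) : ℝ := (1 - symmBinomCdf n k) / (k * symmBinomWeight n k)

theorem lowerMills_nonneg (n k : ℕ) : 0 ≤ lowerMills n k :=
  div_nonneg (cdf_nonneg n k) (mul_nonneg k.cast_nonneg (weight_nonneg n k))

theorem upperMills_nonneg (h : k ≤ n + 1) : 0 ≤ upperMills n k :=
  div_nonneg (by linarith [cdf_le_one h]) (mul_nonneg k.cast_nonneg (weight_nonneg n k))

/-- After the recurrence for the weights this reduces to (n - 2k) P(Z < k) ≤ k P(Z = k), which is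
weaker than `lower_tail`. -/
theorem lowerMills_le_succ (h : k < n) : lowerMills n k ≤ lowerMills n (k + 1) := by
  rcases Nat.eq_zero_or_pos k with rfl | hk
  · simpa [lowerMills] using lowerMills_nonneg n 1
  have hk' : (0 : ℝ) < k := by exact_mod_cast hk
  have hkn : (0 : ℝ) < n - k := by have : (k : ℝ) < n := by exact_mod_cast h
                                   linarith
  have hw := weight_pos h.le
  have hF := cdf_nonneg n k
  have hl := lower_tail n k
  unfold lowerMills
  push_cast
  rw [weight_succ, cdf_succ, div_le_div_iff₀ (by positivity) (by positivity)]
  have : ((n : ℝ) - k) * symmBinomCdf n k ≤ k * (symmBinomCdf n k + symmBinomWeight n k) := by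
    linarith
  nlinarith [mul_le_mul_of_nonneg_right this hw.le]

theorem upperMills_succ_le (hk : 0 < k) (h : k ≤ n) : upperMills n (k + 1) ≤ upperMills n k := by
  rcases h.eq_or_lt with rfl | h
  · simpa [upperMills, cdf_top] using upperMills_nonneg (n := k) (k := k) (by omega)
  have hk' : (0 : ℝ) < k := by exact_mod_cast hk
  have hkn : (0 : ℝ) < n - k := by have : (k : ℝ) < n := by exact_mod_cast h
                                   linarith
  have hw := weight_pos h.le
  have hF := cdf_le_one (n := n) (k := k + 1) (by omega)
  have hl := upper_tail (n := n) (k := k + 1) (by omega)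
  unfold upperMills
  push_cast at hl ⊢
  rw [weight_succ] at hl ⊢
  rw [cdf_succ] at hF hl ⊢
  rw [div_le_div_iff₀ (by positivity) (by positivity)]
  have : (k : ℝ) * (1 - (symmBinomCdf n k + symmBinomWeight n k))
      ≤ (n - k) * (1 - symmBinomCdf n k) := by linarith
  nlinarith [mul_le_mul_of_nonneg_right this hw.le]

theorem lowerMills_mono {j : ℕ} (hkj : k ≤ j) (hj : j ≤ n) : lowerMills n k ≤ lowerMills n j := by
  induction j, hkj using Nat.le_induction with
  | base => exact le_rfl
  | succ j _ ih => exact (ih (by omega)).trans (lowerMills_le_succ (by omega))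

theorem upperMills_anti {j : ℕ} (h0 : 0 < j) (hjk : j ≤ k) (hk : k ≤ n) :
    upperMills n k ≤ upperMills n j := by
  induction k, hjk using Nat.le_induction with
  | base => exact le_rfl
  | succ k hjk ih => exact (upperMills_succ_le (by omega) (by omega)).trans (ih (by omega))

/-- With a = P(Z < k) and b = P(Z > k) the left side is a/k + b/(n - k). Each tail bound, with P(Z =
k) = 1 - a - b inserted, gives an inequality with right side 1; their sum is (n + 1) times the left
side. -/
theorem mills_add_le (hn : 0 < n) (h : k ≤ n) :
    (lowerMills n k + upperMills n (k + 1)) * symmBinomWeight n k ≤ 2 / (n + 1) := by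
  have hw := weight_pos h
  have hl := lower_tail n k
  have hu := upper_tail (n := n) (k := k + 1) (by omega)
  have hn' : (1 : ℝ) ≤ n := by exact_mod_cast hn
  have hF := cdf_nonneg n k
  have hF1 := cdf_le_one (n := n) (k := k + 1) (by omega)
  have hs := cdf_succ n k
  have ea : lowerMills n k * symmBinomWeight n k = symmBinomCdf n k / k := by
    unfold lowerMills; field_simp
  have eb : upperMills n (k + 1) * symmBinomWeight n k
      = (1 - symmBinomCdf n (k + 1)) / (n - k) := by
    unfold upperMills; push_cast; rw [weight_succ]; field_simp
  push_cast at hu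
  rw [weight_succ] at hu
  rw [add_mul, ea, eb]
  -- At k = 0 and at k = n one of the two fractions is a division by zero and hence 0, as it should
  -- be: the corresponding tail is empty.
  rcases Nat.eq_zero_or_pos k with rfl | hk
  · simp only [Nat.cast_zero, div_zero, zero_add, sub_zero]
    rw [div_le_div_iff₀ (by linarith) (by linarith)]
    simp only [zero_add, cdf_zero] at hF1 hs
    nlinarith [cdf_nonneg n 1]
  rcases h.eq_or_lt with rfl | h
  · simp only [sub_self, div_zero, add_zero]
    rw [div_le_div_iff₀ (by linarith) (by linarith)]
    rw [cdf_top] at hs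
    nlinarith
  have hk' : (0 : ℝ) < k := by exact_mod_cast hk
  have hkn : (0 : ℝ) < n - k := by have : (k : ℝ) < n := by exact_mod_cast h
                                   linarith
  set a := symmBinomCdf n k
  set b := 1 - symmBinomCdf n (k + 1) with hb
  have hab : symmBinomWeight n k = 1 - a - b := by rw [hb]; linarith
  have h1 : (n + 1 - k) / k * a + b ≤ 1 := by
    rw [div_mul_eq_mul_div, div_add' _ _ _ hk'.ne', div_le_one hk']
    rw [hab] at hl; linarith
  have h2 : (k + 1) / (n - k) * b + a ≤ 1 := by
    rw [div_mul_eq_mul_div, div_add' _ _ _ hkn.ne', div_le_one hkn]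
    rw [hab] at hu; linarith
  rw [le_div_iff₀ (by linarith)]
  have e1 : (a / k + b / (n - k)) * (n + 1)
      = ((n + 1 - k) / k * a + b) + ((k + 1) / (n - k) * b + a) := by
    field_simp; ring
  linarith

/-- The partial mean `∑_{i < k} w_i h_i`. -/
noncomputable def partialMean (n : ℕ) (h : ℕ → ℝ) (k : ℕ) : ℝ :=
  ∑ i ∈ Finset.range k, symmBinomWeight n i * h i

/-- The solution of the Stein equation for `Bi(n, 1/2)` that vanishes outside `{1, …, n}`. -/
noncomputable def steinSol (n : ℕ) (h : ℕ → ℝ) (k : ℕ) : ℝ :=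
  2 * (partialMean n h k - symmBinomCdf n k * partialMean n h (n + 1)) / (k * symmBinomWeight n k)

variable {h : ℕ → ℝ}

theorem partialMean_succ (n : ℕ) (h : ℕ → ℝ) (k : ℕ) :
    partialMean n h (k + 1) = partialMean n h k + symmBinomWeight n k * h k := by
  simp [partialMean, Finset.sum_range_succ]

theorem steinSol_zero (n : ℕ) (h : ℕ → ℝ) : steinSol n h 0 = 0 := by simp [steinSol]

theorem steinSol_of_gt (hk : n < k) : steinSol n h k = 0 := by simp [steinSol, weight_eq_zero hk]

theorem steinSol_mul (hk : k ≤ n + 1) :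
    (k : ℝ) / 2 * symmBinomWeight n k * steinSol n h k
      = partialMean n h k - symmBinomCdf n k * partialMean n h (n + 1) := by
  rcases Nat.eq_zero_or_pos k with rfl | h0
  · simp [partialMean, cdf_zero]
  rcases hk.eq_or_lt with rfl | hk
  · simp [cdf_top, weight_eq_zero (Nat.lt_succ_self n)]
  have hw := weight_pos (n := n) (k := k) (by omega)
  unfold steinSol
  field_simp

theorem steinSol_equation (hk : k ≤ n) :
    ((n : ℝ) - k) / 2 * steinSol n h (k + 1) - k / 2 * steinSol n h k
      = h k - partialMean n h (n + 1) := by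
  have h1 := steinSol_mul (h := h) (n := n) (k := k) (by omega)
  have h2 := steinSol_mul (h := h) (n := n) (k := k + 1) (by omega)
  have hw := weight_pos hk
  rw [partialMean_succ, cdf_succ] at h2
  push_cast at h2
  have h3 : ((k : ℝ) + 1) / 2 * symmBinomWeight n (k + 1) = (n - k) / 2 * symmBinomWeight n k := by
    linarith [weight_succ n k]
  rw [h3] at h2
  apply mul_left_cancel₀ hw.ne'
  linarith

/-- This separates the values of `h` below `k` from those at or above `k`, with the monotone Mills
ratios as coefficients. -/
theorem steinSol_eq_mills (n : ℕ) (h : ℕ → ℝ) (k : ℕ) :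
    steinSol n h k = 2 * (upperMills n k * partialMean n h k
      - lowerMills n k * (partialMean n h (n + 1) - partialMean n h k)) := by
  unfold steinSol upperMills lowerMills
  ring

theorem partialMean_mono (h0 : ∀ i, 0 ≤ h i) : Monotone (partialMean n h) :=
  monotone_nat_of_le_succ fun k => by
    rw [partialMean_succ]; linarith [mul_nonneg (weight_nonneg n k) (h0 k)]

theorem partialMean_nonneg (h0 : ∀ i, 0 ≤ h i) (k : ℕ) : 0 ≤ partialMean n h k :=
  Finset.sum_nonneg fun i _ => mul_nonneg (weight_nonneg n i) (h0 i)

theorem partialMean_le_cdf (h1 : ∀ i, h i ≤ 1) (k : ℕ) : partialMean n h k ≤ symmBinomCdf n k :=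
  Finset.sum_le_sum fun i _ => mul_le_of_le_one_right (weight_nonneg n i) (h1 i)

theorem partialMean_tail_le (h1 : ∀ i, h i ≤ 1) (hk : k ≤ n + 1) :
    partialMean n h (n + 1) - partialMean n h k ≤ 1 - symmBinomCdf n k := by
  rw [← cdf_top n, partialMean, partialMean, symmBinomCdf, symmBinomCdf,
    ← Finset.sum_Ico_eq_sub _ hk, ← Finset.sum_Ico_eq_sub _ hk]
  exact Finset.sum_le_sum fun i _ => mul_le_of_le_one_right (weight_nonneg n i) (h1 i)

/-- The increment is a positive multiple of `h k` minus nonnegative multiples of the other values of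
`h`. It vanishes for h = 1, so the positive and negative parts have the same maximal size, attained
by the indicator of {k} and bounded by `mills_add_le`. -/
theorem abs_steinSol_succ_sub_le (h0 : ∀ i, 0 ≤ h i) (h1 : ∀ i, h i ≤ 1) (hn : 0 < n) (k : ℕ) :
    |steinSol n h (k + 1) - steinSol n h k| ≤ 4 / (n + 1) := by
  rcases lt_or_ge n k with hk | hk
  · rw [steinSol_of_gt hk, steinSol_of_gt (hk.trans (Nat.lt_succ_self k))]
    simp; positivity
  have hm := mills_add_le hn hk
  set a := lowerMills n k
  set a' := lowerMills n (k + 1)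
  set b := upperMills n k
  set b' := upperMills n (k + 1)
  set w := symmBinomWeight n k
  have hw : 0 < w := weight_pos hk
  have ha : 0 ≤ a := lowerMills_nonneg n k
  have hb' : 0 ≤ b' := upperMills_nonneg (by omega)
  set L := partialMean n h k
  set U := partialMean n h (n + 1) - partialMean n h (k + 1)
  set F := symmBinomCdf n k
  have hL0 : 0 ≤ L := partialMean_nonneg h0 k
  have hLF : L ≤ F := partialMean_le_cdf h1 k
  have hU0 : 0 ≤ U := sub_nonneg.2 (partialMean_mono h0 (by omega))
  have hUF : U ≤ 1 - (F + w) := by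
    have := partialMean_tail_le (h := h) h1 (n := n) (k := k + 1) (by omega)
    rwa [cdf_succ] at this
  -- Monotonicity of the upper ratio fails at k = 0, where `b` is the default value 0, but then `L`
  -- = `F` = 0; similarly for the lower ratio at k = n.
  have hX0 : 0 ≤ (b - b') * L ∧ (b - b') * L ≤ (b - b') * F := by
    rcases Nat.eq_zero_or_pos k with rfl | hk0
    · have : F = 0 := cdf_zero n
      have : L = 0 := by simp [L, partialMean]
      simp_all
    · have : 0 ≤ b - b' := sub_nonneg.2 (upperMills_succ_le hk0 hk)
      exact ⟨by positivity, by gcongr⟩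
  have hY0 : 0 ≤ (a' - a) * U ∧ (a' - a) * U ≤ (a' - a) * (1 - (F + w)) := by
    rcases hk.eq_or_lt with rfl | hkn
    · have : 1 - (F + w) = 0 := by rw [← cdf_succ, cdf_top]; ring
      have : U = 0 := by simp [U]
      simp_all
    · have : 0 ≤ a' - a := sub_nonneg.2 (lowerMills_le_succ hkn)
      exact ⟨by positivity, by gcongr⟩
  have e1 : b * F = a * (1 - F) := by simp only [b, a, F, upperMills, lowerMills]; ring
  have e2 : b' * (F + w) = a' * (1 - (F + w)) := by
    simp only [b', a', F, w, upperMills, lowerMills, ← cdf_succ]; ring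
  have hsum : (b - b') * F + (a' - a) * (1 - (F + w)) = (a + b') * w := by linear_combination e1 - e2
  have hZ0 : 0 ≤ (a + b') * w * h k := mul_nonneg (by positivity) (h0 k)
  have hZ1 : (a + b') * w * h k ≤ (a + b') * w := mul_le_of_le_one_right (by positivity) (h1 k)
  have e : steinSol n h (k + 1) - steinSol n h k
      = 2 * ((a + b') * w * h k - (b - b') * L - (a' - a) * U) := by
    rw [steinSol_eq_mills, steinSol_eq_mills]
    have e3 : partialMean n h (n + 1) - partialMean n h k = U + w * h k := by
      simp only [U, w, partialMean_succ n h k]; ring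
    have e4 : partialMean n h (k + 1) = L + w * h k := partialMean_succ n h k
    rw [e3, e4, show partialMean n h (n + 1) - (L + w * h k) = U by simp only [U, e4]]
    ring
  have h4 : (4 : ℝ) / (n + 1) = 2 * (2 / (n + 1)) := by ring
  rw [e, abs_le, h4]
  constructor <;> linarith [hX0.1, hX0.2, hY0.1, hY0.2]

/-- The numerator equals (1 - F)L - FU for the parts L ≤ F and U ≤ 1 - F of the mean below `k` and
from `k` on, so its modulus is at most F(1 - F). -/
theorem abs_steinSol_le_of_weight_le (h0 : ∀ i, 0 ≤ h i) (h1 : ∀ i, h i ≤ 1)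
    {c : ℝ} (hc : ∀ i, symmBinomWeight n i ≤ c)
    (hvar : ∀ k, k ≤ n + 1 →
      symmBinomCdf n k * (1 - symmBinomCdf n k) ≤ c * (k * symmBinomWeight n k)) (k : ℕ) :
    |steinSol n h k| ≤ 2 * c := by
  have hc0 : 0 ≤ c := (weight_nonneg n 0).trans (hc 0)
  rcases lt_or_ge n k with hk | hk
  · rw [steinSol_of_gt hk]; simpa using hc0
  rcases Nat.eq_zero_or_pos k with rfl | hk0
  · rw [steinSol_zero]; simpa using hc0
  have hw := weight_pos hk
  have hk' : (0 : ℝ) < k := by exact_mod_cast hk0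
  have hv := hvar k (by omega)
  unfold steinSol
  rw [abs_div, abs_mul, abs_two, abs_of_pos (by positivity : 0 < (k : ℝ) * symmBinomWeight n k),
    div_le_iff₀ (by positivity), mul_assoc]
  refine mul_le_mul_of_nonneg_left (le_trans ?_ hv) zero_le_two
  have hL0 := partialMean_nonneg (n := n) h0 k
  have hLF := partialMean_le_cdf (n := n) h1 k
  have hU0 := sub_nonneg.2 (partialMean_mono (n := n) h0 (show k ≤ n + 1 by omega))
  have hUF := partialMean_tail_le (n := n) h1 (show k ≤ n + 1 by omega)
  have hF := cdf_nonneg n k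
  have hF1 := cdf_le_one (n := n) (k := k) (by omega)
  rw [abs_le]
  constructor <;> nlinarith

theorem weight_symm (hk : k ≤ n) : symmBinomWeight n (n - k) = symmBinomWeight n k := by
  simp only [symmBinomWeight, Nat.choose_symm hk]

theorem cdf_add_cdf_reflect (hk : k ≤ n + 1) :
    symmBinomCdf n k + symmBinomCdf n (n + 1 - k) = 1 := by
  induction k with
  | zero => simp [cdf_zero, cdf_top]
  | succ k ih =>
    have h1 := ih (by omega)
    have h2 : n + 1 - k = (n - k) + 1 := by omega
    rw [h2, cdf_succ, weight_symm (by omega)] at h1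
    rw [cdf_succ, show n + 1 - (k + 1) = n - k by omega]
    linarith

theorem cdf_sub_le {c : ℝ} (hc : ∀ i, symmBinomWeight n i ≤ c) {j : ℕ} (hkj : k ≤ j) :
    symmBinomCdf n j - symmBinomCdf n k ≤ c * (j - k) := by
  rw [symmBinomCdf, symmBinomCdf, ← Finset.sum_Ico_eq_sub _ hkj, ← Nat.cast_sub hkj, mul_comm]
  simpa using Finset.sum_le_card_nsmul (Finset.Ico k j) _ c fun i _ => hc i

/-- From k to k + 1 the left side grows by w_k(1 - F_k - F_{k+1}). By reflection the bracket is a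
sum of n - 2k weights, hence at most c(n - 2k), while k w_k grows by exactly (n - 2k) w_k. -/
theorem cdf_mul_le_of_two_mul_le {c : ℝ} (hc : ∀ i, symmBinomWeight n i ≤ c) (hk : 2 * k ≤ n + 2) :
    symmBinomCdf n k * (1 - symmBinomCdf n k) ≤ c * (k * symmBinomWeight n k) := by
  induction k with
  | zero => simp [cdf_zero]
  | succ k ih =>
    have h1 := ih (by omega)
    have h2 := cdf_add_cdf_reflect (n := n) (k := k + 1) (by omega)
    rw [show n + 1 - (k + 1) = n - k by omega, cdf_succ] at h2
    have h3 := cdf_sub_le hc (show k ≤ n - k by omega)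
    rw [Nat.cast_sub (by omega)] at h3
    have h4 : 1 - symmBinomCdf n k - (symmBinomCdf n k + symmBinomWeight n k)
        ≤ c * (n - 2 * k) := by linarith
    have h5 := mul_le_mul_of_nonneg_left h4 (weight_nonneg n k)
    push_cast
    rw [weight_succ, cdf_succ]
    linarith

/-- Both sides are invariant under k ↦ n + 1 - k, which reduces to the lower half. -/
theorem cdf_mul_le {c : ℝ} (hc : ∀ i, symmBinomWeight n i ≤ c) (hk : k ≤ n + 1) :
    symmBinomCdf n k * (1 - symmBinomCdf n k) ≤ c * (k * symmBinomWeight n k) := by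
  rcases le_or_gt (2 * k) (n + 2) with h | h
  · exact cdf_mul_le_of_two_mul_le hc h
  rcases hk.eq_or_lt with rfl | hk'
  · simp [cdf_top, weight_eq_zero (Nat.lt_succ_self n)]
  have h1 := cdf_mul_le_of_two_mul_le hc (show 2 * (n + 1 - k) ≤ n + 2 by omega)
  have h2 := cdf_add_cdf_reflect hk
  have h3 := weight_succ n (n - k)
  rw [weight_symm (by omega), show n - k + 1 = n + 1 - k by omega, Nat.cast_sub (by omega)] at h3
  rw [show symmBinomCdf n (n + 1 - k) = 1 - symmBinomCdf n k by linarith, Nat.cast_sub hk] at h1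
  push_cast at h1
  rw [show (n : ℝ) + 1 - k = n - k + 1 by ring, h3] at h1
  linarith

/-- The sup-norm bound for the Stein solution. -/
theorem abs_steinSol_le {c : ℝ} (h0 : ∀ i, 0 ≤ h i) (h1 : ∀ i, h i ≤ 1)
    (hc : ∀ i, symmBinomWeight n i ≤ c) (k : ℕ) : |steinSol n h k| ≤ 2 * c :=
  abs_steinSol_le_of_weight_le h0 h1 hc (fun _ => cdf_mul_le hc) k

/-- Only one term of `steinSol_eq_mills` survives on each side of `j`. By monotonicity of the ratios
it is extremal at k = j or k = j + 1, where `mills_add_le` applies. -/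
theorem abs_steinSol_le_of_subsingleton (hn : 0 < n) {j : ℕ} (h0 : ∀ i, 0 ≤ h i)
    (h1 : ∀ i, h i ≤ 1) (hj : ∀ i, i ≠ j → h i = 0) (k : ℕ) :
    |steinSol n h k| ≤ 4 / (n + 1) := by
  have hpos : (0 : ℝ) ≤ 4 / (n + 1) := by positivity
  rcases lt_or_ge n k with hk | hk
  · rwa [steinSol_of_gt hk, abs_zero]
  have hS : ∀ m, partialMean n h m = if j < m then symmBinomWeight n j * h j else 0 := by
    intro m
    rw [partialMean, ← Finset.sum_subset_zero_on_sdiff (s₁ := (Finset.range m).filter (· = j))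
      (Finset.filter_subset _ _) (g := fun i => symmBinomWeight n i * h i) _ (fun _ _ => rfl)]
    · rw [Finset.filter_eq']; split_ifs <;> simp_all
    · intro x hx
      simp only [Finset.mem_sdiff, Finset.mem_filter, not_and] at hx
      simp [hj x (hx.2 hx.1)]
  have hw := weight_nonneg n j
  rcases lt_or_ge n j with hjn | hjn
  · rw [steinSol_eq_mills, hS, hS, if_neg (by omega), if_neg (by omega)]; simpa using hpos
  rw [steinSol_eq_mills, hS k, hS (n + 1), if_pos (Nat.lt_succ_of_le hjn)]
  have hm := mills_add_le hn hjn
  have ha := lowerMills_nonneg n j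
  have hb := upperMills_nonneg (n := n) (k := j + 1) (by omega)
  have hwh : symmBinomWeight n j * h j ≤ symmBinomWeight n j := mul_le_of_le_one_right hw (h1 j)
  have hwh0 : 0 ≤ symmBinomWeight n j * h j := mul_nonneg hw (h0 j)
  have h4 : (4 : ℝ) / (n + 1) = 2 * (2 / (n + 1)) := by ring
  rw [h4, abs_mul, abs_two]
  refine mul_le_mul_of_nonneg_left (le_trans ?_ hm) zero_le_two
  split_ifs with hjk
  · have hb' := upperMills_anti (n := n) (by omega) (show j + 1 ≤ k from hjk) hk
    have hb0 := upperMills_nonneg (n := n) (k := k) (by omega)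
    rw [sub_self, mul_zero, sub_zero, abs_of_nonneg (by positivity)]
    nlinarith [mul_le_mul hb' hwh hwh0 hb, mul_nonneg ha hw]
  · have ha' := lowerMills_mono (n := n) (show k ≤ j by omega) hjn
    have ha0 := lowerMills_nonneg n k
    rw [mul_zero, zero_sub, sub_zero, abs_neg, abs_of_nonneg (by positivity)]
    nlinarith [mul_le_mul ha' hwh hwh0 ha, mul_nonneg hb hw]

end SymmBinom

/-! ### Smoothing by fair coins. -/

/-- The average of a function on `ℤ` over a step of a fair `{0, 1}`-valued coin. -/
noncomputable def coinAvg : Module.End ℝ (ℤ → ℝ) where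
  toFun f := fun k => (f k + f (k + 1)) / 2
  map_add' f g := by ext k; simp only [Pi.add_apply]; ring
  map_smul' c f := by ext k; simp only [Pi.smul_apply, smul_eq_mul, RingHom.id_apply]; ring

/-- The forward difference operator on functions on `ℤ`. -/
def zdiff : Module.End ℝ (ℤ → ℝ) where
  toFun f := fun k => f (k + 1) - f k
  map_add' f g := by ext k; simp only [Pi.add_apply]; ring
  map_smul' c f := by ext k; simp only [Pi.smul_apply, smul_eq_mul, RingHom.id_apply]; ring

theorem coinAvg_apply (f : ℤ → ℝ) (k : ℤ) : coinAvg f k = (f k + f (k + 1)) / 2 := rfl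

theorem zdiff_apply (f : ℤ → ℝ) (k : ℤ) : zdiff f k = f (k + 1) - f k := rfl

theorem coinAvg_pow_succ (n : ℕ) (f : ℤ → ℝ) :
    (coinAvg ^ (n + 1)) f = (coinAvg ^ n) (coinAvg f) := by
  rw [pow_succ, Module.End.mul_apply]

theorem coinAvg_pow_succ' (n : ℕ) (f : ℤ → ℝ) :
    (coinAvg ^ (n + 1)) f = coinAvg ((coinAvg ^ n) f) := by
  rw [pow_succ', Module.End.mul_apply]

theorem commute_coinAvg_zdiff : Commute coinAvg zdiff := by
  refine LinearMap.ext fun f => funext fun k => ?_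
  simp only [Module.End.mul_apply, coinAvg_apply, zdiff_apply]
  ring

theorem coinAvg_pow_zdiff (n : ℕ) (f : ℤ → ℝ) :
    (coinAvg ^ n) (zdiff f) = zdiff ((coinAvg ^ n) f) := by
  rw [← Module.End.mul_apply, (commute_coinAvg_zdiff.pow_left n).eq, Module.End.mul_apply]

theorem coinAvg_pow_mono (n : ℕ) {f g : ℤ → ℝ} (h : ∀ k, f k ≤ g k) (k : ℤ) :
    (coinAvg ^ n) f k ≤ (coinAvg ^ n) g k := by
  induction n generalizing f g with
  | zero => exact h k
  | succ n ih =>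
    rw [coinAvg_pow_succ, coinAvg_pow_succ]
    exact ih fun j => by rw [coinAvg_apply, coinAvg_apply]; linarith [h j, h (j + 1)]

theorem coinAvg_pow_const (n : ℕ) (c : ℝ) : (coinAvg ^ n) (fun _ => c) = fun _ => c := by
  induction n with
  | zero => rfl
  | succ n ih =>
    rw [coinAvg_pow_succ, show coinAvg (fun _ => c) = fun _ => c by
      ext k; rw [coinAvg_apply]; ring, ih]

theorem abs_coinAvg_pow_le_of_abs_le (n : ℕ) {f g : ℤ → ℝ} (h : ∀ k, |f k| ≤ g k) (k : ℤ) :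
    |(coinAvg ^ n) f k| ≤ (coinAvg ^ n) g k := by
  have h1 := coinAvg_pow_mono n (fun j => (abs_le.1 (h j)).2) k
  have h2 := coinAvg_pow_mono n (f := -g) (fun j => (abs_le.1 (h j)).1) k
  rw [map_neg, Pi.neg_apply] at h2
  exact abs_le.2 ⟨h2, h1⟩

theorem abs_coinAvg_pow_le (n : ℕ) {f : ℤ → ℝ} {M : ℝ} (h : ∀ k, |f k| ≤ M) (k : ℤ) :
    |(coinAvg ^ n) f k| ≤ M := by
  simpa [coinAvg_pow_const] using abs_coinAvg_pow_le_of_abs_le n (g := fun _ => M) h k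

theorem coinAvg_pow_sq (n : ℕ) (c : ℝ) (y : ℤ) :
    (coinAvg ^ n) (fun x : ℤ => (2 * (x : ℝ) - c) ^ 2) y = (2 * y + n - c) ^ 2 + n := by
  induction n generalizing c with
  | zero => simp
  | succ n ih =>
    have : coinAvg (fun x : ℤ => (2 * (x : ℝ) - c) ^ 2)
        = (fun x : ℤ => (2 * (x : ℝ) - (c - 1)) ^ 2) + fun _ => 1 := by
      ext k; simp only [coinAvg_apply, Pi.add_apply]; push_cast; ring
    rw [coinAvg_pow_succ, this, map_add, Pi.add_apply, ih, coinAvg_pow_const]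
    push_cast; ring

/-- The Stein identity of the symmetric binomial distribution. -/
theorem coinAvg_pow_mul (n : ℕ) (c : ℝ) (f : ℤ → ℝ) (y : ℤ) :
    (coinAvg ^ (n + 1)) (fun x : ℤ => (2 * (x : ℝ) - c) * f x) y
      = (2 * y + (n + 1) - c) * (coinAvg ^ (n + 1)) f y
        + (n + 1) / 2 * (coinAvg ^ n) (zdiff f) y := by
  have key : ∀ (c : ℝ) (f : ℤ → ℝ), coinAvg (fun x : ℤ => (2 * (x : ℝ) - c) * f x)
      = (fun x : ℤ => (2 * (x : ℝ) - (c - 1)) * coinAvg f x) + (1 / 2 : ℝ) • zdiff f := by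
    intro c f
    ext k
    simp only [coinAvg_apply, zdiff_apply, Pi.add_apply, Pi.smul_apply, smul_eq_mul]
    push_cast; ring
  induction n generalizing c f with
  | zero =>
    rw [zero_add, pow_one, key]
    simp only [Pi.add_apply, Pi.smul_apply, smul_eq_mul, pow_zero, Module.End.one_apply]
    push_cast; ring
  | succ n ih =>
    rw [coinAvg_pow_succ, key, map_add, map_smul, Pi.add_apply, Pi.smul_apply, smul_eq_mul, ih,
      ← coinAvg_pow_succ]
    have : (coinAvg ^ n) (zdiff (coinAvg f)) = (coinAvg ^ (n + 1)) (zdiff f) := by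
      rw [coinAvg_pow_succ, ← Module.End.mul_apply zdiff, ← Module.End.mul_apply coinAvg,
        commute_coinAvg_zdiff.eq]
    rw [this]
    push_cast; ring

/-- The Stein identity with c = 2y + n + 1, the centring, expresses the smoothed difference through
the mean of (2x - c) f(x). The elementary bound |t| ≤ t²/(2s) + s/2 then leaves only a variance. The
parameter `s` stays free so that the bound is affine in 1/(n + 1) and can later be averaged over a
random `n`. -/
theorem abs_coinAvg_pow_zdiff_le (n : ℕ) {f : ℤ → ℝ} {M s : ℝ} (hs : 0 < s) (h : ∀ k, |f k| ≤ M)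
    (y : ℤ) : |(coinAvg ^ n) (zdiff f) y| ≤ M * (1 / s + s / (n + 1)) := by
  have hM : 0 ≤ M := (abs_nonneg _).trans (h 0)
  have h1 := coinAvg_pow_mul n (2 * y + (n + 1)) f y
  rw [sub_self, zero_mul, zero_add] at h1
  have h2 := abs_coinAvg_pow_le_of_abs_le (n + 1)
    (f := fun x : ℤ => (2 * (x : ℝ) - (2 * y + (n + 1))) * f x)
    (g := (M / (2 * s)) • (fun x : ℤ => (2 * (x : ℝ) - (2 * y + (n + 1))) ^ 2)
      + fun _ => M * s / 2) (fun x => by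
      simp only [Pi.add_apply, Pi.smul_apply, smul_eq_mul]
      set t : ℝ := 2 * (x : ℝ) - (2 * y + (n + 1))
      rw [abs_mul]
      have h3 : |t| * |f x| ≤ |t| * M := mul_le_mul_of_nonneg_left (h x) (abs_nonneg t)
      have h4 : M / (2 * s) * t ^ 2 + M * s / 2 - |t| * M = M / (2 * s) * (|t| - s) ^ 2 := by
        rw [← sq_abs t]; field_simp; ring
      have h5 : 0 ≤ M / (2 * s) * (|t| - s) ^ 2 := by positivity
      linarith) y
  rw [map_add, map_smul, Pi.add_apply, Pi.smul_apply, coinAvg_pow_sq, coinAvg_pow_const, h1,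
    abs_mul, abs_of_pos (by positivity : (0 : ℝ) < (n + 1) / 2), smul_eq_mul] at h2
  push_cast at h2
  have h6 : M / (2 * s) * ((2 * (y : ℝ) + (n + 1) - (2 * y + (n + 1))) ^ 2 + (n + 1)) + M * s / 2
      = (n + 1) / 2 * (M * (1 / s + s / (n + 1))) := by
    field_simp; ring
  rw [h6] at h2
  exact le_of_mul_le_mul_left h2 (by positivity)

theorem abs_coinAvg_pow_zdiff_le_sqrt (n : ℕ) {f : ℤ → ℝ} {M : ℝ} (h : ∀ k, |f k| ≤ M) (y : ℤ) :
    |(coinAvg ^ n) (zdiff f) y| ≤ 2 * M / √(n + 1) := by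
  have hs : (0 : ℝ) < √(n + 1) := Real.sqrt_pos.2 (by positivity)
  refine (abs_coinAvg_pow_zdiff_le n hs h y).trans_eq ?_
  nth_rw 3 [← Real.sq_sqrt (by positivity : (0 : ℝ) ≤ n + 1)]
  field_simp; ring

/-- Half of the coins smooth each of the two differences. -/
theorem abs_coinAvg_pow_zdiff_zdiff_le (n : ℕ) {f : ℤ → ℝ} {M : ℝ} (h : ∀ k, |f k| ≤ M) (y : ℤ) :
    |(coinAvg ^ n) (zdiff (zdiff f)) y| ≤ 8 * M / (n + 1) := by
  have hM : 0 ≤ M := (abs_nonneg _).trans (h 0)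
  obtain ⟨a, b, hn, hab, hba⟩ : ∃ a b : ℕ, n = a + b ∧ a ≤ b ∧ b ≤ a + 1 :=
    ⟨n / 2, n - n / 2, by omega, by omega, by omega⟩
  have e : (coinAvg ^ n) (zdiff (zdiff f)) = (coinAvg ^ a) (zdiff ((coinAvg ^ b) (zdiff f))) := by
    rw [hn, pow_add, Module.End.mul_apply, coinAvg_pow_zdiff b (zdiff f)]
  rw [e]
  refine (abs_coinAvg_pow_zdiff_le_sqrt a (abs_coinAvg_pow_zdiff_le_sqrt b h) y).trans ?_
  have ha : √((a : ℝ) + 1) * √((a : ℝ) + 1) = a + 1 := Real.mul_self_sqrt (by positivity)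
  have hapos : (0 : ℝ) < √((a : ℝ) + 1) := Real.sqrt_pos.2 (by positivity)
  have hab' : √((a : ℝ) + 1) ≤ √((b : ℝ) + 1) :=
    Real.sqrt_le_sqrt (by have : (a : ℝ) ≤ b := by exact_mod_cast hab
                          linarith)
  have hn' : (n : ℝ) + 1 ≤ 2 * (a + 1) := by
    have : n ≤ 2 * a + 1 := by omega
    have : (n : ℝ) ≤ 2 * a + 1 := by exact_mod_cast this
    linarith
  calc 2 * (2 * M / √((b : ℝ) + 1)) / √((a : ℝ) + 1)
      ≤ 2 * (2 * M / √((a : ℝ) + 1)) / √((a : ℝ) + 1) := by gcongr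
    _ = 4 * M / (√((a : ℝ) + 1) * √((a : ℝ) + 1)) := by field_simp; ring
    _ = 4 * M / (a + 1) := by rw [ha]
    _ ≤ 8 * M / (n + 1) := by
      rw [div_le_div_iff₀ (by positivity) (by positivity)]
      nlinarith [mul_le_mul_of_nonneg_left hn' hM]

theorem coinAvg_pow_eq_sum (n : ℕ) (f : ℤ → ℝ) (y : ℤ) :
    (coinAvg ^ n) f y = ∑ k ∈ Finset.range (n + 1), symmBinomWeight n k * f (y + k) := by
  induction n generalizing f with
  | zero => simp [symmBinomWeight]
  | succ n ih =>
    rw [coinAvg_pow_succ, ih, Finset.sum_range_succ' _ (n + 1)]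
    have h1 : ∀ k : ℕ, symmBinomWeight (n + 1) (k + 1)
        = (symmBinomWeight n k + symmBinomWeight n (k + 1)) / 2 := by
      intro k
      simp only [symmBinomWeight, Nat.choose_succ_succ]
      push_cast; field_simp; ring
    have h0 : symmBinomWeight (n + 1) 0 = symmBinomWeight n 0 / 2 := by
      simp only [symmBinomWeight, Nat.choose_zero_right]; field_simp; ring
    have h2 : ∑ k ∈ Finset.range (n + 1), symmBinomWeight n (k + 1) * f (y + ((k + 1 : ℕ) : ℤ))
        + symmBinomWeight n 0 * f (y + ((0 : ℕ) : ℤ))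
        = ∑ k ∈ Finset.range (n + 1), symmBinomWeight n k * f (y + (k : ℤ)) := by
      rw [← Finset.sum_range_succ' (fun k : ℕ => symmBinomWeight n k * f (y + (k : ℤ))),
        Finset.sum_range_succ, SymmBinom.weight_eq_zero (Nat.lt_succ_self n)]
      simp
    simp only [coinAvg_apply, h1, h0]
    have h3 : ∀ k : ℕ, y + ((k + 1 : ℕ) : ℤ) = y + k + 1 := fun k => by push_cast; ring
    simp only [h3] at h2 ⊢
    have h4 : ∑ k ∈ Finset.range (n + 1), symmBinomWeight n k * ((f (y + k) + f (y + k + 1)) / 2)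
        = (∑ k ∈ Finset.range (n + 1), symmBinomWeight n k * f (y + (k : ℤ))) / 2
          + (∑ k ∈ Finset.range (n + 1), symmBinomWeight n k * f (y + (k : ℤ) + 1)) / 2 := by
      rw [Finset.sum_div, Finset.sum_div, ← Finset.sum_add_distrib]
      exact Finset.sum_congr rfl fun k _ => by ring
    have h5 : ∑ k ∈ Finset.range (n + 1),
          (symmBinomWeight n k + symmBinomWeight n (k + 1)) / 2 * f (y + k + 1)
        = (∑ k ∈ Finset.range (n + 1), symmBinomWeight n k * f (y + (k : ℤ) + 1)) / 2
          + (∑ k ∈ Finset.range (n + 1), symmBinomWeight n (k + 1) * f (y + (k : ℤ) + 1)) / 2 := by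
      rw [Finset.sum_div, Finset.sum_div, ← Finset.sum_add_distrib]
      exact Finset.sum_congr rfl fun k _ => by ring
    rw [h4, h5, ← h2]
    ring

/-- A point mass is half the difference of a function with values ±1, so the smoothing bound applies
with M = 1. -/
theorem symmBinomWeight_le (n k : ℕ) : symmBinomWeight n k ≤ 1 / √(n + 1) := by
  rcases lt_or_ge n k with hk | hk
  · rw [SymmBinom.weight_eq_zero hk]; positivity
  have h := abs_coinAvg_pow_zdiff_le_sqrt n (M := 1)
    (f := fun x : ℤ => if x ≤ (k : ℤ) then 1 else -1) (fun x => by split_ifs <;> simp) 0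
  have e : zdiff (fun x : ℤ => if x ≤ (k : ℤ) then (1 : ℝ) else -1)
      = fun x : ℤ => if x = (k : ℤ) then -2 else 0 := by
    ext x
    rw [zdiff_apply]
    split_ifs <;> first | omega | norm_num
  rw [e, coinAvg_pow_eq_sum, Finset.sum_eq_single k] at h
  · rw [zero_add, if_pos rfl, abs_mul, abs_of_nonneg (SymmBinom.weight_nonneg n k)] at h
    norm_num at h
    rw [one_div]
    have e2 : (2 : ℝ) / √(n + 1) = 2 * (√(n + 1))⁻¹ := div_eq_mul_inv _ _
    linarith
  · intro b _ hb
    rw [if_neg (by simpa using hb), mul_zero]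
  · intro hk'
    exact absurd (Finset.mem_range.2 (Nat.lt_succ_of_le hk)) hk'

/-! ### The Mineka decomposition. -/

/-- The mass `∑ₓ min (ν {x}) (ν {x + 1})` of the overlap of a law on `ℤ` and its unit shift. -/
noncomputable def shiftOverlap (ν : Measure ℤ) : ℝ := ∑' x, min (ν.real {x}) (ν.real {x + 1})

theorem hasSum_measureReal_singleton (ν : Measure ℤ) [IsProbabilityMeasure ν] :
    HasSum (fun x => ν.real {x}) 1 := by
  have h := hasSum_integral_measure (μ := fun x => ν {x} • Measure.dirac x) (f := fun _ => (1 : ℝ))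
    (by rw [Measure.sum_smul_dirac]; exact integrable_const _)
  rw [Measure.sum_smul_dirac] at h
  simpa [Measure.real] using h

theorem summable_overlap (ν : Measure ℤ) [IsProbabilityMeasure ν] :
    Summable fun x => min (ν.real {x}) (ν.real {x + 1}) :=
  Summable.of_nonneg_of_le (fun _ => le_min measureReal_nonneg measureReal_nonneg)
    (fun _ => min_le_left _ _) (hasSum_measureReal_singleton ν).summable

theorem shiftOverlap_le_one (ν : Measure ℤ) [IsProbabilityMeasure ν] : shiftOverlap ν ≤ 1 := by
  rw [← (hasSum_measureReal_singleton ν).tsum_eq]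
  exact (summable_overlap ν).tsum_le_tsum (fun _ => min_le_left _ _)
    (hasSum_measureReal_singleton ν).summable

theorem shiftOverlap_nonneg (ν : Measure ℤ) : 0 ≤ shiftOverlap ν :=
  tsum_nonneg fun _ => le_min measureReal_nonneg measureReal_nonneg

theorem integrable_of_abs_le {α : Type*} [MeasurableSpace α] {ν : Measure α} [IsFiniteMeasure ν]
    {f : α → ℝ} (hf : Measurable f) {M : ℝ} (h : ∀ k, |f k| ≤ M) : Integrable f ν :=
  Integrable.of_bound hf.aestronglyMeasurable M (Filter.Eventually.of_forall h)

theorem abs_tsum_mul_le {m G : ℤ → ℝ} {c : ℝ} (hm : Summable m) (hm0 : ∀ x, 0 ≤ m x)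
    (hG : ∀ x, |G x| ≤ c) : Summable (fun x => m x * G x) ∧ |∑' x, m x * G x| ≤ (∑' x, m x) * c := by
  have h1 : ∀ x, ‖m x * G x‖ ≤ m x * c := fun x => by
    rw [Real.norm_eq_abs, abs_mul, abs_of_nonneg (hm0 x)]
    exact mul_le_mul_of_nonneg_left (hG x) (hm0 x)
  have h2 := hm.mul_right c
  refine ⟨Summable.of_norm_bounded h2 h1, ?_⟩
  rw [← tsum_mul_right]
  exact tsum_of_norm_bounded h2.hasSum h1

/-- The Mineka decomposition: with probability `shiftOverlap ν`, a variable with law `ν` contains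
an independent fair coin. -/
theorem abs_integral_le_of_coinAvg (ν : Measure ℤ) [IsProbabilityMeasure ν] {f : ℤ → ℝ} {α β : ℝ}
    (hα : ∀ k, |f k| ≤ α) (hβ : ∀ k, |coinAvg f k| ≤ β) :
    |∫ x, f x ∂ν| ≤ shiftOverlap ν * β + (1 - shiftOverlap ν) * α := by
  have hp := hasSum_measureReal_singleton ν
  have hm := summable_overlap ν
  set p : ℤ → ℝ := fun x => ν.real {x}
  set m : ℤ → ℝ := fun x => min (p x) (p (x + 1)) with hmdef
  have hm0 : ∀ x, 0 ≤ m x := fun _ => le_min measureReal_nonneg measureReal_nonneg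
  set e : ℤ ≃ ℤ := Equiv.addRight (-1)
  have hm' : Summable (fun x => m (x - 1)) := (e.summable_iff (f := m)).2 hm
  have hmt : ∑' x, m (x - 1) = ∑' x, m x := e.tsum_eq m
  -- What remains after removing a fair step from x to x or x + 1 with weight `m x`. Both `m x` and
  -- `m (x - 1)` are at most `p x`, so the remainder is nonnegative.
  set r : ℤ → ℝ := fun x => p x - (m x / 2 + m (x - 1) / 2) with hr
  have hr0 : ∀ x, 0 ≤ r x := fun x => by
    have h1 : m x ≤ p x := min_le_left _ _
    have h2 : m (x - 1) ≤ p x := by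
      simp only [hmdef, sub_add_cancel]; exact min_le_right _ _
    simp only [hr]; linarith
  have hms := (hm.div_const 2).add (hm'.div_const 2)
  have hrs : Summable r := hp.summable.sub hms
  have hrt : ∑' x, r x = 1 - shiftOverlap ν := by
    rw [hp.summable.tsum_sub hms, hp.tsum_eq, (hm.div_const 2).tsum_add (hm'.div_const 2),
      tsum_div_const, tsum_div_const, hmt]
    change 1 - ((∑' x, m x) / 2 + (∑' x, m x) / 2) = 1 - ∑' x, m x
    ring
  have h1 := abs_tsum_mul_le hm hm0 hβ
  have h2 := abs_tsum_mul_le hrs hr0 hα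
  have ha := abs_tsum_mul_le hm hm0 hα
  have hb := abs_tsum_mul_le hm hm0 (fun x => hα (x + 1))
  have hc := abs_tsum_mul_le hm' (fun x => hm0 (x - 1)) hα
  have hcb : ∑' x, m (x - 1) * f x = ∑' x, m x * f (x + 1) := by
    rw [← (Equiv.addRight (1 : ℤ)).tsum_eq]
    simp
  have e1 : ∑' x, m x * coinAvg f x = (∑' x, m x * f x) / 2 + (∑' x, m x * f (x + 1)) / 2 := by
    rw [← tsum_div_const, ← tsum_div_const, ← (ha.1.div_const 2).tsum_add (hb.1.div_const 2)]
    exact tsum_congr fun x => by rw [coinAvg_apply]; ring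
  have e2 : ∫ x, f x ∂ν = ∑' x, m x * coinAvg f x + ∑' x, r x * f x := by
    rw [integral_countable (integrable_of_abs_le (by fun_prop) hα), e1, ← hcb,
      ← tsum_div_const, ← tsum_div_const, ← (ha.1.div_const 2).tsum_add (hc.1.div_const 2),
      ← ((ha.1.div_const 2).add (hc.1.div_const 2)).tsum_add h2.1]
    refine tsum_congr fun x => ?_
    simp only [hr, smul_eq_mul]
    change p x * f x = _
    ring
  rw [e2, ← hrt]
  exact (abs_add_le _ _).trans (add_le_add h1.2 h2.2)

/-! ### Smoothness of sums of independent variables. -/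

section indep

variable {Ω : Type*} [MeasurableSpace Ω] {P : Measure Ω} [IsProbabilityMeasure P]

theorem integral_comp_indepFun {X Z : Ω → ℤ} (hX : Measurable X) (hZ : Measurable Z)
    (h : IndepFun X Z P) (G : ℤ → ℤ → ℝ) (hG : Integrable (fun ω => G (X ω) (Z ω)) P) :
    ∫ ω, G (X ω) (Z ω) ∂P = ∫ x, ∫ ω, G x (Z ω) ∂P ∂(P.map X) := by
  have h1 := (indepFun_iff_map_prod_eq_prod_map_map hX.aemeasurable hZ.aemeasurable).1 h
  have hXZ : Measurable fun ω => (X ω, Z ω) := hX.prodMk hZ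
  have hGm : Measurable (Function.uncurry G) := by fun_prop
  have : IsProbabilityMeasure (P.map X) := Measure.isProbabilityMeasure_map hX.aemeasurable
  have : IsProbabilityMeasure (P.map Z) := Measure.isProbabilityMeasure_map hZ.aemeasurable
  have h2 : Integrable (Function.uncurry G) ((P.map X).prod (P.map Z)) := by
    rw [← h1, integrable_map_measure hGm.aestronglyMeasurable hXZ.aemeasurable]
    exact hG
  have h3 : ∫ ω, G (X ω) (Z ω) ∂P = ∫ p, Function.uncurry G p ∂(P.map fun ω => (X ω, Z ω)) := by
    rw [integral_map hXZ.aemeasurable hGm.aestronglyMeasurable]; rfl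
  rw [h3, h1, integral_prod _ h2]
  refine integral_congr_ae (Filter.Eventually.of_forall fun x => ?_)
  simp only [Function.uncurry_apply_pair]
  rw [integral_map hZ.aemeasurable (by fun_prop)]

variable {J : Type*} {ξ : J → Ω → ℤ}

theorem coinAvg_integral {Z : Ω → ℤ} (hZ : Measurable Z) {f : ℤ → ℝ} {M : ℝ} (hf : ∀ k, |f k| ≤ M)
    (k : ℤ) : coinAvg (fun y => ∫ ω, f (y + Z ω) ∂P) k = ∫ ω, coinAvg f (k + Z ω) ∂P := by
  simp only [coinAvg_apply]
  rw [integral_div, integral_add]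
  · congr 2
    exact integral_congr_ae (Filter.Eventually.of_forall fun ω => by
      change f _ = f _; congr 1; ring)
  · exact integrable_of_abs_le (by fun_prop) fun ω => hf _
  · exact integrable_of_abs_le (by fun_prop) fun ω => hf _

/-- Each variable adds one coin with probability u_i, so the bound is a + b E 1/(N + K + 1) with K a
sum of independent Bernoulli(u_i) variables. Writing 1/(N + K + 1) as the integral of x^(N+K) turns
the expectation into a product and makes the induction close. -/
theorem abs_integral_sum_le (hmeas : ∀ i, Measurable (ξ i)) (hind : iIndepFun ξ P)
    {a b M : ℝ} (f : ℤ → ℝ) (hM : ∀ k, |f k| ≤ M)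
    (hf : ∀ (N : ℕ) k, |(coinAvg ^ N) f k| ≤ a + b / (N + 1)) (S : Finset J) (N : ℕ) (y : ℤ) :
    |∫ ω, (coinAvg ^ N) f (y + ∑ i ∈ S, ξ i ω) ∂P|
      ≤ a + b * ∫ x in (0 : ℝ)..1,
          x ^ N * ∏ i ∈ S, (1 - shiftOverlap (P.map (ξ i)) + shiftOverlap (P.map (ξ i)) * x) := by
  classical
  induction S using Finset.induction_on generalizing N y with
  | empty =>
    simpa [div_eq_mul_inv] using hf N y
  | insert j S hj ih =>
    set u := shiftOverlap (P.map (ξ j)) with hu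
    have hprob : IsProbabilityMeasure (P.map (ξ j)) :=
      Measure.isProbabilityMeasure_map (hmeas j).aemeasurable
    have hS : Measurable fun ω => ∑ i ∈ S, ξ i ω := Finset.measurable_sum _ fun i _ => hmeas i
    have hjS : IndepFun (ξ j) (fun ω => ∑ i ∈ S, ξ i ω) P := by
      have := (hind.indepFun_finsetSum_of_notMem hmeas hj).symm
      convert this using 1
      ext ω; simp
    have hbd := abs_coinAvg_pow_le N hM
    have e1 : ∫ ω, (coinAvg ^ N) f (y + ∑ i ∈ insert j S, ξ i ω) ∂P
        = ∫ x, ∫ ω, (coinAvg ^ N) f (y + x + ∑ i ∈ S, ξ i ω) ∂P ∂(P.map (ξ j)) := by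
      rw [← integral_comp_indepFun (hmeas j) hS hjS
        (fun x z => (coinAvg ^ N) f (y + x + z))
        (integrable_of_abs_le (by fun_prop) fun ω => hbd _)]
      simp only [Finset.sum_insert hj, add_assoc]
    have e2 := abs_integral_le_of_coinAvg (P.map (ξ j))
      (f := fun x => ∫ ω, (coinAvg ^ N) f (y + x + ∑ i ∈ S, ξ i ω) ∂P)
      (fun x => ih N (y + x))
      (β := _) (fun x => by
        have := coinAvg_integral (P := P) hS hbd (y + x)
        rw [← coinAvg_pow_succ'] at this
        have h3 := ih (N + 1) (y + x)
        rw [← this] at h3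
        rw [coinAvg_apply] at h3 ⊢
        rw [← add_assoc y x 1]
        exact h3)
    rw [e1]
    refine e2.trans_eq ?_
    rw [← hu]
    have hcont : ∀ N : ℕ, IntervalIntegrable (fun x : ℝ => x ^ N * ∏ i ∈ S,
        (1 - shiftOverlap (P.map (ξ i)) + shiftOverlap (P.map (ξ i)) * x)) volume 0 1 :=
      fun N => Continuous.intervalIntegrable (by fun_prop) _ _
    have e3 : ∫ x in (0 : ℝ)..1, x ^ N * ∏ i ∈ insert j S,
          (1 - shiftOverlap (P.map (ξ i)) + shiftOverlap (P.map (ξ i)) * x)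
        = u * (∫ x in (0 : ℝ)..1, x ^ (N + 1) * ∏ i ∈ S,
            (1 - shiftOverlap (P.map (ξ i)) + shiftOverlap (P.map (ξ i)) * x))
          + (1 - u) * ∫ x in (0 : ℝ)..1, x ^ N * ∏ i ∈ S,
            (1 - shiftOverlap (P.map (ξ i)) + shiftOverlap (P.map (ξ i)) * x) := by
      rw [← intervalIntegral.integral_const_mul, ← intervalIntegral.integral_const_mul,
        ← intervalIntegral.integral_add ((hcont _).const_mul _) ((hcont _).const_mul _)]
      refine intervalIntegral.integral_congr fun x _ => ?_
      simp only [Finset.prod_insert hj, ← hu]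
      ring
    rw [e3]
    ring

/-- Each factor is at most exp(-u_i(1 - x)), and the resulting exponential integrates to less than
1/∑ u_i. -/
theorem integral_prod_overlap_le {ι : Type*} (S : Finset ι) (u : ι → ℝ) (h1 : ∀ i, u i ≤ 1)
    (h0 : ∀ i, 0 ≤ u i) (hpos : 0 < ∑ i ∈ S, u i) :
    ∫ x in (0 : ℝ)..1, ∏ i ∈ S, (1 - u i + u i * x) ≤ 1 / ∑ i ∈ S, u i := by
  set U := ∑ i ∈ S, u i
  have hderiv : ∀ x ∈ Set.uIcc (0 : ℝ) 1,
      HasDerivAt (fun x => Real.exp (-U * (1 - x)) / U) (Real.exp (-U * (1 - x))) x := by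
    intro x _
    have : HasDerivAt (fun x : ℝ => -U * (1 - x)) U x := by
      simpa using ((hasDerivAt_id x).const_sub 1).const_mul (-U)
    have h2 := this.exp.div_const U
    rwa [mul_div_assoc, div_self hpos.ne', mul_one] at h2
  have hint : IntervalIntegrable (fun x : ℝ => Real.exp (-U * (1 - x))) volume 0 1 :=
    Continuous.intervalIntegrable (by fun_prop) _ _
  have e := intervalIntegral.integral_eq_sub_of_hasDerivAt hderiv hint
  calc ∫ x in (0 : ℝ)..1, ∏ i ∈ S, (1 - u i + u i * x)
      ≤ ∫ x in (0 : ℝ)..1, Real.exp (-U * (1 - x)) := by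
        refine intervalIntegral.integral_mono_on zero_le_one
          (Continuous.intervalIntegrable (by fun_prop) _ _) hint fun x hx => ?_
        rw [show -U * (1 - x) = ∑ i ∈ S, -(u i * (1 - x)) by
          rw [Finset.sum_neg_distrib, ← Finset.sum_mul]; ring, Real.exp_sum]
        refine Finset.prod_le_prod (fun i _ => ?_) fun i _ => ?_
        · nlinarith [hx.1, h1 i, h0 i, mul_nonneg (h0 i) hx.1]
        · have := Real.add_one_le_exp (-(u i * (1 - x)))
          linarith
    _ = 1 / U - Real.exp (-U) / U := by rw [e]; simp
    _ ≤ 1 / U := by have := Real.exp_pos (-U)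
                    have : 0 ≤ Real.exp (-U) / U := by positivity
                    linarith

theorem abs_integral_le_of_overlap (hmeas : ∀ i, Measurable (ξ i)) (hind : iIndepFun ξ P)
    {a b M : ℝ} (hb : 0 ≤ b) (f : ℤ → ℝ) (hM : ∀ k, |f k| ≤ M)
    (hf : ∀ (N : ℕ) k, |(coinAvg ^ N) f k| ≤ a + b / (N + 1)) (S : Finset J) {U : ℝ}
    (hU0 : 0 < U) (hU : U ≤ ∑ i ∈ S, shiftOverlap (P.map (ξ i))) (y : ℤ) :
    |∫ ω, f (y + ∑ i ∈ S, ξ i ω) ∂P| ≤ a + b / U := by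
  have hprob : ∀ i, IsProbabilityMeasure (P.map (ξ i)) := fun i =>
    Measure.isProbabilityMeasure_map (hmeas i).aemeasurable
  have h1 := abs_integral_sum_le hmeas hind f hM hf S 0 y
  simp only [pow_zero, Module.End.one_apply, one_mul] at h1
  have h2 := integral_prod_overlap_le S (fun i => shiftOverlap (P.map (ξ i)))
    (fun i => shiftOverlap_le_one _) (fun i => shiftOverlap_nonneg _) (hU0.trans_le hU)
  have h3 : 1 / ∑ i ∈ S, shiftOverlap (P.map (ξ i)) ≤ 1 / U := one_div_le_one_div_of_le hU0 hU
  have h4 := mul_le_mul_of_nonneg_left (h2.trans h3) hb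
  rw [mul_one_div] at h4
  linarith

theorem abs_zdiff_le {f : ℤ → ℝ} {M : ℝ} (h : ∀ k, |f k| ≤ M) (k : ℤ) : |zdiff f k| ≤ 2 * M := by
  rw [zdiff_apply]
  have := abs_sub (f (k + 1)) (f k)
  linarith [h k, h (k + 1)]

/-- The free parameter of `abs_coinAvg_pow_zdiff_le` is taken to be √U, which balances the two
terms. -/
theorem abs_integral_zdiff_le (hmeas : ∀ i, Measurable (ξ i)) (hind : iIndepFun ξ P)
    {M : ℝ} {f : ℤ → ℝ} (hM : ∀ k, |f k| ≤ M) (S : Finset J) {U : ℝ}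
    (hU0 : 0 < U) (hU : U ≤ ∑ i ∈ S, shiftOverlap (P.map (ξ i))) (y : ℤ) :
    |∫ ω, zdiff f (y + ∑ i ∈ S, ξ i ω) ∂P| ≤ 2 * M / √U := by
  have hM0 : 0 ≤ M := (abs_nonneg _).trans (hM 0)
  have hs : 0 < √U := Real.sqrt_pos.2 hU0
  have h := abs_integral_le_of_overlap hmeas hind (a := M / √U) (b := M * √U) (by positivity)
    (zdiff f) (abs_zdiff_le hM) (fun N k => by
      refine (abs_coinAvg_pow_zdiff_le N hs hM k).trans_eq ?_
      field_simp) S hU0 hU y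
  refine h.trans_eq ?_
  nth_rw 3 [← Real.sq_sqrt hU0.le]
  field_simp; ring

theorem abs_integral_zdiff_zdiff_le (hmeas : ∀ i, Measurable (ξ i)) (hind : iIndepFun ξ P)
    {M : ℝ} {f : ℤ → ℝ} (hM : ∀ k, |f k| ≤ M) (S : Finset J) {U : ℝ}
    (hU0 : 0 < U) (hU : U ≤ ∑ i ∈ S, shiftOverlap (P.map (ξ i))) (y : ℤ) :
    |∫ ω, zdiff (zdiff f) (y + ∑ i ∈ S, ξ i ω) ∂P| ≤ 8 * M / U := by
  have hM0 : 0 ≤ M := (abs_nonneg _).trans (hM 0)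
  simpa using abs_integral_le_of_overlap hmeas hind (a := 0) (b := 8 * M) (by positivity)
    (zdiff (zdiff f)) (abs_zdiff_le (abs_zdiff_le hM)) (fun N k => by
      simpa using abs_coinAvg_pow_zdiff_zdiff_le N hM k) S hU0 hU y

end indep

/-! ### Overlap and total variation. -/

theorem le_dTV (μ ν : Measure ℝ) [IsProbabilityMeasure μ] [IsProbabilityMeasure ν] {A : Set ℝ}
    (hA : MeasurableSet A) : |μ.real A - ν.real A| ≤ dTV μ ν := by
  refine le_ciSup (f := fun A : {A : Set ℝ // MeasurableSet A} => |μ.real A - ν.real A|)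
    ⟨1, ?_⟩ ⟨A, hA⟩
  rintro _ ⟨B, rfl⟩
  have h1 : μ.real B ≤ 1 := measureReal_le_one
  have h2 : ν.real B ≤ 1 := measureReal_le_one
  have h3 : 0 ≤ μ.real B := measureReal_nonneg
  have h4 : 0 ≤ ν.real B := measureReal_nonneg
  exact abs_le.2 ⟨by linarith, by linarith⟩

theorem one_sub_shiftOverlap_le_dTV {Ω : Type*} [MeasurableSpace Ω] (P : Measure Ω)
    [IsProbabilityMeasure P] {X : Ω → ℤ} (hX : Measurable X) :
    1 - shiftOverlap (P.map X) ≤ dTV (intLaw P X) (intLaw P fun ω => X ω + 1) := by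
  have hprob : IsProbabilityMeasure (P.map X) := Measure.isProbabilityMeasure_map hX.aemeasurable
  have hX' : Measurable fun ω => (X ω : ℝ) := by fun_prop
  have hX1 : Measurable fun ω => ((X ω + 1 : ℤ) : ℝ) := by fun_prop
  have : IsProbabilityMeasure (intLaw P X) := Measure.isProbabilityMeasure_map hX'.aemeasurable
  have : IsProbabilityMeasure (intLaw P fun ω => X ω + 1) :=
    Measure.isProbabilityMeasure_map hX1.aemeasurable
  set ν := P.map X
  set p : ℤ → ℝ := fun x => ν.real {x} with hp
  have hps : HasSum p 1 := hasSum_measureReal_singleton ν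
  -- The extremal set for X against X + 1: on it p(x) exceeds the shifted mass p(x - 1), and the
  -- difference of probabilities is exactly ∑ (p(x) - min(p(x - 1), p(x))).
  set B : Set ℤ := {x | p (x - 1) < p x} with hB
  have hA : MeasurableSet ((fun x : ℤ => (x : ℝ)) '' B) :=
    (B.to_countable.image _).measurableSet
  refine le_trans ?_ ((le_abs_self _).trans (le_dTV _ _ hA))
  have hreal : ∀ C : Set ℤ, ν.real C = ∑' x, p x * C.indicator 1 x := by
    intro C
    have hC : MeasurableSet C := .of_discrete
    have hi : Integrable (C.indicator (1 : ℤ → ℝ)) ν := (integrable_const (1 : ℝ)).indicator hC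
    rw [← integral_indicator_one hC, integral_countable hi]
    rfl
  have hsum : ∀ C : Set ℤ, Summable fun x => p x * C.indicator 1 x := fun C =>
    (abs_tsum_mul_le (c := 1) hps.summable (fun x => measureReal_nonneg) fun x => by
      by_cases h : x ∈ C <;> simp [h]).1
  have e1 : (intLaw P X).real ((fun x : ℤ => (x : ℝ)) '' B) = ∑' x, p x * B.indicator 1 x := by
    rw [← hreal, intLaw, map_measureReal_apply hX' hA, map_measureReal_apply hX .of_discrete]
    congr 1
    ext ω; simp
  have e2 : (intLaw P fun ω => X ω + 1).real ((fun x : ℤ => (x : ℝ)) '' B)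
      = ∑' x, p x * ((fun x => x + 1) ⁻¹' B).indicator 1 x := by
    rw [← hreal, intLaw, map_measureReal_apply hX1 hA, map_measureReal_apply hX .of_discrete]
    congr 1
    ext ω
    simp only [Set.mem_preimage, Set.mem_image, Int.cast_inj, exists_eq_right]
  have e3 : ∑' x, p x * ((fun x : ℤ => x + 1) ⁻¹' B).indicator (1 : ℤ → ℝ) x
      = ∑' x, p (x - 1) * B.indicator 1 x := by
    rw [← (Equiv.addRight (1 : ℤ)).tsum_eq fun x => p (x - 1) * B.indicator (1 : ℤ → ℝ) x]
    refine tsum_congr fun x => ?_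
    simp only [Equiv.coe_addRight, add_sub_cancel_right]
    rfl
  have hs3 : Summable fun x => p (x - 1) * B.indicator (1 : ℤ → ℝ) x := by
    have := (Equiv.addRight (-1 : ℤ)).summable_iff.2 (hsum ((fun x => x + 1) ⁻¹' B))
    refine this.congr fun x => ?_
    simp only [Function.comp, Equiv.coe_addRight, Set.indicator, Set.mem_preimage]
    rw [← sub_eq_add_neg, sub_add_cancel]
    rfl
  have hm := summable_overlap ν
  have hmt : ∑' x, min (p (x - 1)) (p x) = shiftOverlap ν := by
    rw [shiftOverlap, ← (Equiv.addRight (1 : ℤ)).tsum_eq]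
    simp [hp]
  have hms : Summable fun x => min (p (x - 1)) (p x) := by
    refine ((Equiv.addRight (-1 : ℤ)).summable_iff.2 hm).congr fun x => ?_
    simp [hp, sub_eq_add_neg]
  rw [e1, e2, e3, ← (hsum B).tsum_sub hs3, ← hmt, ← hps.tsum_eq, ← hps.summable.tsum_sub hms]
  refine le_of_eq (tsum_congr fun x => ?_)
  by_cases h : x ∈ B
  · simp [h, min_eq_left (le_of_lt (show p (x - 1) < p x from h))]
  · simp [h, min_eq_right (not_lt.1 (show ¬ p (x - 1) < p x from h))]

theorem smoothness_le_shiftOverlap {Ω : Type*} [MeasurableSpace Ω] (P : Measure Ω)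
    [IsProbabilityMeasure P] {X : Ω → ℤ} (hX : Measurable X) :
    smoothness P X ≤ shiftOverlap (P.map X) := by
  have := one_sub_shiftOverlap_le_dTV P hX
  exact (min_le_right _ _).trans (by linarith)

/-! ### A moment inequality. -/

theorem integral_sub_const_sq {α : Type*} [MeasurableSpace α] {ν : Measure α}
    [IsProbabilityMeasure ν] {Y : α → ℝ} (h1 : Integrable Y ν)
    (h2 : Integrable (fun x => Y x ^ 2) ν) (c : ℝ) :
    ∫ x, (Y x - c) ^ 2 ∂ν = ∫ x, Y x ^ 2 ∂ν - 2 * c * ∫ x, Y x ∂ν + c ^ 2 := by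
  have h3 : Integrable (fun x => Y x ^ 2 - 2 * c * Y x) ν := h2.sub (h1.const_mul _)
  have : ∀ x, (Y x - c) ^ 2 = Y x ^ 2 - 2 * c * Y x + c ^ 2 := fun x => by ring
  simp only [this]
  rw [integral_add h3 (integrable_const _), integral_sub h2 (h1.const_mul _), integral_const_mul,
    integral_const]
  simp

theorem sq_integral_le {α : Type*} [MeasurableSpace α] {ν : Measure α} [IsProbabilityMeasure ν]
    {Y : α → ℝ} (h1 : Integrable Y ν) (h2 : Integrable (fun x => Y x ^ 2) ν) :
    (∫ x, Y x ∂ν) ^ 2 ≤ ∫ x, Y x ^ 2 ∂ν := by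
  have h : 0 ≤ ∫ x, (Y x - ∫ z, Y z ∂ν) ^ 2 ∂ν := integral_nonneg fun x => sq_nonneg _
  rw [integral_sub_const_sq h1 h2] at h
  linarith

theorem integral_linear_combination_six {α : Type*} [MeasurableSpace α] {ν : Measure α}
    {f₁ f₂ f₃ f₄ f₅ f₆ : α → ℝ} (h₁ : Integrable f₁ ν) (h₂ : Integrable f₂ ν)
    (h₃ : Integrable f₃ ν) (h₄ : Integrable f₄ ν) (h₅ : Integrable f₅ ν) (h₆ : Integrable f₆ ν) :
    Integrable (fun x => (f₁ x + f₂ x + f₃ x + f₄ x - 2 * f₅ x - 2 * f₆ x) / 2) ν ∧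
    ∫ x, (f₁ x + f₂ x + f₃ x + f₄ x - 2 * f₅ x - 2 * f₆ x) / 2 ∂ν
      = (∫ x, f₁ x ∂ν + ∫ x, f₂ x ∂ν + ∫ x, f₃ x ∂ν + ∫ x, f₄ x ∂ν
        - 2 * ∫ x, f₅ x ∂ν - 2 * ∫ x, f₆ x ∂ν) / 2 := by
  have k2 : Integrable (fun x => f₁ x + f₂ x) ν := h₁.add h₂
  have k3 : Integrable (fun x => f₁ x + f₂ x + f₃ x) ν := k2.add h₃
  have k4 : Integrable (fun x => f₁ x + f₂ x + f₃ x + f₄ x) ν := k3.add h₄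
  have k5 : Integrable (fun x => f₁ x + f₂ x + f₃ x + f₄ x - 2 * f₅ x) ν :=
    k4.sub (h₅.const_mul 2)
  refine ⟨(k5.sub (h₆.const_mul 2)).div_const 2, ?_⟩
  rw [integral_div, integral_sub k5 (h₆.const_mul 2), integral_sub k4 (h₅.const_mul 2),
    integral_add k3 h₄, integral_add k2 h₃, integral_add h₁ h₂, integral_const_mul,
    integral_const_mul]

theorem moment_inequality_aux {m a t s : ℝ} (hm : 0 ≤ m) (hs : 0 ≤ s) (hma : m ≤ a)
    (ha : a ^ 2 ≤ s ^ 2 + m ^ 2) (hp : ((a + m) / 2) ^ 2 ≤ (s ^ 2 + m ^ 2 + t) / 2) :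
    a * (s ^ 2 + m ^ 2) - 2 * m * t ≤ 2 * s ^ 3 := by
  -- In the application a = E|X| and m = EX, so `N` is the mean of the negative part of X.
  obtain ⟨N, rfl⟩ : ∃ N, a = m + 2 * N := ⟨(a - m) / 2, by ring⟩
  have hN0 : 0 ≤ N := by linarith
  have hN : N ≤ s / 2 := by
    have : (2 * N) ^ 2 ≤ s ^ 2 := by nlinarith [mul_nonneg hm hN0]
    have := (sq_le_sq₀ (by linarith) hs).1 this
    linarith
  have ht : 2 * ((m + N) ^ 2) - s ^ 2 - m ^ 2 ≤ t := by
    have : ((m + 2 * N + m) / 2) ^ 2 = (m + N) ^ 2 := by ring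
    rw [this] at hp; linarith
  have h1 : (m + 2 * N) * (s ^ 2 + m ^ 2) - 2 * m * t
      ≤ 3 * m * s ^ 2 - m ^ 3 + 2 * N * (s ^ 2 - 3 * m ^ 2) := by
    nlinarith [mul_le_mul_of_nonneg_left ht hm, mul_nonneg hm (sq_nonneg N)]
  refine h1.trans ?_
  -- The bound is affine in `N`, so only the ends of 0 ≤ N ≤ s/2 matter. The deficits there are (s -
  -- m)³ + 2m³ at N = s/2 and (s - m)²(2s + m) at N = 0.
  rcases le_or_gt (3 * m ^ 2) (s ^ 2) with h | h
  · have : 2 * N * (s ^ 2 - 3 * m ^ 2) ≤ s * (s ^ 2 - 3 * m ^ 2) :=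
      mul_le_mul_of_nonneg_right (by linarith) (by linarith)
    have hms : m ≤ s := by nlinarith
    nlinarith [pow_nonneg (sub_nonneg.2 hms) 3, pow_nonneg hm 3]
  · have : 2 * N * (s ^ 2 - 3 * m ^ 2) ≤ 0 := by nlinarith
    nlinarith [mul_nonneg (sq_nonneg (s - m)) (by linarith : 0 ≤ 2 * s + m)]

/-- The three inputs are E X ≤ E|X| and Cauchy–Schwarz for |X| and for the positive part of X, whose
square is (X² + X|X|)/2. The left side is even in X, so E X ≥ 0 may be assumed. -/
theorem moment_inequality {α : Type*} [MeasurableSpace α] {ν : Measure α} [IsProbabilityMeasure ν]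
    {X : α → ℝ} (hX : MemLp X 2 ν) :
    (∫ x, |X x| ∂ν) * (∫ x, X x ^ 2 ∂ν) - 2 * (∫ x, X x ∂ν) * ∫ x, X x * |X x| ∂ν
      ≤ 2 * √(∫ x, X x ^ 2 ∂ν - (∫ x, X x ∂ν) ^ 2) ^ 3 := by
  wlog hm : 0 ≤ ∫ x, X x ∂ν generalizing X
  · have := this hX.neg (by simp only [Pi.neg_apply, integral_neg]; linarith)
    simpa [integral_neg] using this
  have h1 : Integrable X ν := hX.integrable one_le_two
  have h2 : Integrable (fun x => X x ^ 2) ν := hX.integrable_sq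
  have h3 : Integrable (fun x => X x * |X x|) ν := by
    refine h2.mono (h1.aestronglyMeasurable.mul h1.abs.aestronglyMeasurable)
      (Filter.Eventually.of_forall fun x => ?_)
    simp [sq]
  have hs := sq_integral_le h1 h2
  set m := ∫ x, X x ∂ν
  have ha := sq_integral_le h1.abs (by simpa using h2)
  have hp := sq_integral_le (Y := fun x => (|X x| + X x) / 2) ((h1.abs.add h1).div_const 2) (by
    have : ∀ x, ((|X x| + X x) / 2) ^ 2 = (X x ^ 2 + X x * |X x|) / 2 := fun x => by
      linear_combination (1 / 4) * sq_abs (X x)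
    simp only [this]
    exact (h2.add h3).div_const 2)
  have e : ∀ x, ((|X x| + X x) / 2) ^ 2 = (X x ^ 2 + X x * |X x|) / 2 := fun x => by
    linear_combination (1 / 4) * sq_abs (X x)
  simp only [e] at hp
  rw [integral_div, integral_div, integral_add h1.abs h1, integral_add h2 h3] at hp
  simp only [sq_abs] at ha
  have hsq : √(∫ x, X x ^ 2 ∂ν - m ^ 2) ^ 2 = ∫ x, X x ^ 2 ∂ν - m ^ 2 :=
    Real.sq_sqrt (by linarith)
  have key := moment_inequality_aux hm (Real.sqrt_nonneg (∫ x, X x ^ 2 ∂ν - m ^ 2))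
    (a := ∫ x, |X x| ∂ν) (t := ∫ x, X x * |X x| ∂ν)
    (integral_mono h1 h1.abs fun x => le_abs_self _) (by rw [hsq]; linarith)
    (by rw [hsq]; linarith)
  rw [hsq] at key
  simpa using key

/-! ### The Taylor remainder for one summand. -/

/-- The primitive of the absolute value. -/
noncomputable def halfSignedSq (x : ℝ) : ℝ := x * |x| / 2

theorem halfSignedSq_int_succ_sub (j : ℤ) :
    halfSignedSq ((j : ℝ) + 1) - halfSignedSq j = (|(j : ℝ)| + |(j : ℝ) + 1|) / 2 := by
  unfold halfSignedSq
  rcases le_or_gt 0 j with h | h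
  · have h' : (0 : ℝ) ≤ j := by exact_mod_cast h
    rw [abs_of_nonneg h', abs_of_nonneg (by linarith)]; ring
  · have h' : (j : ℝ) + 1 ≤ 0 := by exact_mod_cast h
    rw [abs_of_nonpos (by linarith : (j : ℝ) ≤ 0), abs_of_nonpos h']; ring

theorem abs_halfSignedSq (x : ℝ) : |halfSignedSq x| = x ^ 2 / 2 := by
  rw [halfSignedSq, abs_div, abs_mul, abs_abs, abs_two, ← sq, sq_abs]

section

variable {ν : Measure ℤ} [IsProbabilityMeasure ν]

theorem integrable_of_cubic_bound (h3 : Integrable (fun x : ℤ => |(x : ℝ)| ^ 3) ν) {f : ℤ → ℝ}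
    (C : ℝ) (hf : ∀ x : ℤ, |f x| ≤ C * (1 + |(x : ℝ)| ^ 3)) : Integrable f ν :=
  (((integrable_const 1).add h3).const_mul C).mono' (by fun_prop)
    (Filter.Eventually.of_forall hf)

theorem pow_le_one_add_cube {t : ℝ} (ht : 0 ≤ t) {j : ℕ} (hj : j ≤ 3) : t ^ j ≤ 1 + t ^ 3 := by
  rcases le_or_gt t 1 with h | h
  · have := pow_le_one₀ (n := j) ht h
    have := pow_nonneg ht 3
    linarith
  · have := pow_le_pow_right₀ h.le hj
    linarith

/-- Subtracting the value of `f` at ⌊m⌋ does not change the integral and makes the integrand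
pointwise nonnegative. -/
theorem integral_sub_mean_mul_nonneg (h1 : Integrable (fun x : ℤ => (x : ℝ)) ν) {m : ℝ}
    (hm : m = ∫ x : ℤ, (x : ℝ) ∂ν) {f : ℤ → ℝ} (hf : Monotone f)
    (hint : Integrable (fun x : ℤ => ((x : ℝ) - m) * f x) ν) :
    0 ≤ ∫ x : ℤ, ((x : ℝ) - m) * f x ∂ν := by
  have h0 : ∫ x : ℤ, ((x : ℝ) - m) * f ⌊m⌋ ∂ν = 0 := by
    rw [integral_mul_const, integral_sub h1 (integrable_const _), ← hm]
    simp
  have hc : Integrable (fun x : ℤ => ((x : ℝ) - m) * f ⌊m⌋) ν :=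
    (h1.sub (integrable_const m)).mul_const _
  have h : 0 ≤ ∫ x : ℤ, (((x : ℝ) - m) * f x - ((x : ℝ) - m) * f ⌊m⌋) ∂ν := by
    refine integral_nonneg fun x => ?_
    simp only [Pi.zero_apply, ← mul_sub]
    rcases le_or_gt (x : ℝ) m with h | h
    · exact mul_nonneg_of_nonpos_of_nonpos (by linarith) (sub_nonpos.2 (hf (Int.le_floor.2 h)))
    · exact mul_nonneg (by linarith) (sub_nonneg.2 (hf (Int.floor_le_iff.2 (by linarith))))
  rwa [integral_sub hint hc, h0, sub_zero] at h

/-- The symmetrised third moment, and the constant of the Taylor remainder. -/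
theorem integral_integral_halfSignedSq_le (h3 : Integrable (fun x : ℤ => |(x : ℝ)| ^ 3) ν) {m : ℝ}
    (hm : m = ∫ x : ℤ, (x : ℝ) ∂ν) :
    Integrable (fun c : ℤ => ∫ x : ℤ, ((x : ℝ) - m) * halfSignedSq (x - c) ∂ν) ν ∧
    ∫ c : ℤ, ∫ x : ℤ, ((x : ℝ) - m) * halfSignedSq (x - c) ∂ν ∂ν
      ≤ √(∫ x : ℤ, ((x : ℝ) - m) ^ 2 ∂ν) ^ 3 + (∫ x : ℤ, |(x : ℝ)| ^ 3 ∂ν) / 2 := by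
  have hpow : ∀ j : ℕ, j ≤ 3 → Integrable (fun x : ℤ => |(x : ℝ)| ^ j) ν := fun j hj =>
    integrable_of_cubic_bound h3 1 fun x => by
      rw [abs_of_nonneg (by positivity), one_mul]
      exact pow_le_one_add_cube (abs_nonneg _) hj
  have i1 : Integrable (fun x : ℤ => |(x : ℝ)|) ν := by simpa using hpow 1 (by norm_num)
  have i1' : Integrable (fun x : ℤ => (x : ℝ)) ν := i1.mono' (by fun_prop) (by simp)
  have i2 : Integrable (fun x : ℤ => (x : ℝ) ^ 2) ν := by simpa using hpow 2 (by norm_num)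
  have i2' : Integrable (fun x : ℤ => (x : ℝ) * |(x : ℝ)|) ν :=
    i2.mono' (by fun_prop) (Filter.Eventually.of_forall fun x => by simp [sq])
  have i0 : Integrable (fun _ : ℤ => (1 : ℝ)) ν := integrable_const _
  have hP : Integrable (fun p : ℤ × ℤ => ((p.1 : ℝ) - m) * halfSignedSq (p.1 - p.2))
      (ν.prod ν) := by
    have hdom : Integrable (fun p : ℤ × ℤ =>
        (1 + |(p.1 : ℝ)| ^ 3) * (1 + |(p.2 : ℝ)| ^ 3) * (2 * (1 + |m|))) (ν.prod ν) :=
      ((i0.add h3).mul_prod (i0.add h3)).mul_const _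
    refine hdom.mono' (by fun_prop) (Filter.Eventually.of_forall fun p => ?_)
    rw [Real.norm_eq_abs, abs_mul, abs_halfSignedSq]
    set a := |(p.1 : ℝ)|
    set b := |(p.2 : ℝ)|
    have ha : 0 ≤ a := abs_nonneg _
    have hb : 0 ≤ b := abs_nonneg _
    have hm0 := abs_nonneg m
    have e1 : |(p.1 : ℝ) - m| ≤ a + |m| := abs_sub _ _
    have e2 : ((p.1 : ℝ) - p.2) ^ 2 / 2 ≤ a ^ 2 + b ^ 2 := by
      have := sq_abs (p.1 : ℝ)
      have := sq_abs (p.2 : ℝ)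
      nlinarith [sq_nonneg ((p.1 : ℝ) + p.2)]
    have a1 : a ≤ 1 + a ^ 3 := by simpa using pow_le_one_add_cube ha (show 1 ≤ 3 by norm_num)
    have a2 := pow_le_one_add_cube ha (show 2 ≤ 3 by norm_num)
    have b2 := pow_le_one_add_cube hb (show 2 ≤ 3 by norm_num)
    have a3 := pow_nonneg ha 3
    have b3 := pow_nonneg hb 3
    calc |(p.1 : ℝ) - m| * (((p.1 : ℝ) - p.2) ^ 2 / 2) ≤ (a + |m|) * (a ^ 2 + b ^ 2) := by gcongr
      _ = a ^ 3 + a * b ^ 2 + |m| * a ^ 2 + |m| * b ^ 2 := by ring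
      _ ≤ (1 + a ^ 3) * (1 + b ^ 3) + (1 + a ^ 3) * (1 + b ^ 3)
          + |m| * ((1 + a ^ 3) * (1 + b ^ 3)) + |m| * ((1 + a ^ 3) * (1 + b ^ 3)) := by
        have t1 : a * b ^ 2 ≤ (1 + a ^ 3) * (1 + b ^ 3) :=
          mul_le_mul a1 b2 (sq_nonneg b) (by linarith)
        have t0 : a ^ 3 ≤ (1 + a ^ 3) * (1 + b ^ 3) := by nlinarith [mul_nonneg a3 b3]
        have t2 : a ^ 2 ≤ (1 + a ^ 3) * (1 + b ^ 3) := by nlinarith [mul_nonneg a3 b3]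
        have t3 : b ^ 2 ≤ (1 + a ^ 3) * (1 + b ^ 3) := by nlinarith [mul_nonneg a3 b3]
        gcongr
      _ = (1 + a ^ 3) * (1 + b ^ 3) * (2 * (1 + |m|)) := by ring
  have hP' : Integrable (fun p : ℤ × ℤ => ((p.2 : ℝ) - m) * halfSignedSq (p.2 - p.1))
      (ν.prod ν) := hP.swap
  refine ⟨hP.swap.integral_prod_left, ?_⟩
  set I := ∫ p : ℤ × ℤ, ((p.1 : ℝ) - m) * halfSignedSq (p.1 - p.2) ∂(ν.prod ν) with hI
  have hI' : ∫ p : ℤ × ℤ, ((p.2 : ℝ) - m) * halfSignedSq (p.2 - p.1) ∂(ν.prod ν) = I :=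
    integral_prod_swap (fun p : ℤ × ℤ => ((p.1 : ℝ) - m) * halfSignedSq (p.1 - p.2))
  have e0 : ∫ c : ℤ, ∫ x : ℤ, ((x : ℝ) - m) * halfSignedSq (x - c) ∂ν ∂ν = I := by
    rw [← hI', integral_prod _ hP']
  rw [e0]
  set a := ∫ x : ℤ, |(x : ℝ)| ∂ν
  set t := ∫ x : ℤ, (x : ℝ) * |(x : ℝ)| ∂ν
  set b := ∫ x : ℤ, (x : ℝ) ^ 2 ∂ν
  set T := ∫ x : ℤ, |(x : ℝ)| ^ 3 ∂ν
  -- The primitive is odd, so exchanging the two independent copies gives 2I = E|X - Y|³/2. Bounding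
  -- one factor |X - Y| by |X| + |Y| leaves a combination of product moments to which
  -- `moment_inequality` applies.
  have hub : 2 * I ≤ (2 * T + 2 * (a * b) - 4 * (t * m)) / 2 := by
    have j1 := h3.mul_prod (i0 : Integrable _ ν)
    have j2 := (i0 : Integrable _ ν).mul_prod h3
    have j3 := i1.mul_prod (ν := ν) i2
    have j4 := i2.mul_prod (ν := ν) i1
    have j5 := i2'.mul_prod (ν := ν) i1'
    have j6 := i1'.mul_prod (ν := ν) i2'
    have hsix := integral_linear_combination_six j1 j2 j3 j4 j5 j6
    have hle : 2 * I ≤ ∫ p : ℤ × ℤ, (|(p.1 : ℝ)| ^ 3 * 1 + 1 * |(p.2 : ℝ)| ^ 3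
        + |(p.1 : ℝ)| * (p.2 : ℝ) ^ 2 + (p.1 : ℝ) ^ 2 * |(p.2 : ℝ)|
        - 2 * ((p.1 : ℝ) * |(p.1 : ℝ)| * p.2) - 2 * ((p.1 : ℝ) * ((p.2 : ℝ) * |(p.2 : ℝ)|))) / 2
          ∂(ν.prod ν) := by
      rw [two_mul]
      nth_rw 2 [← hI']
      rw [hI, ← integral_add hP hP']
      refine integral_mono (hP.add hP') hsix.1 fun p => ?_
      set x : ℝ := (p.1 : ℝ)
      set y : ℝ := (p.2 : ℝ)
      have hxy : |y - x| = |x - y| := abs_sub_comm _ _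
      have htri : |x - y| ≤ |x| + |y| := abs_sub _ _
      have e : (x - m) * halfSignedSq (x - y) + (y - m) * halfSignedSq (y - x)
          = (x - y) ^ 2 * |x - y| / 2 := by
        unfold halfSignedSq; rw [hxy]; ring
      have hx2 := sq_abs x
      have hy2 := sq_abs y
      calc (x - m) * halfSignedSq (x - y) + (y - m) * halfSignedSq (y - x)
          = (x - y) ^ 2 * |x - y| / 2 := e
        _ ≤ (x - y) ^ 2 * (|x| + |y|) / 2 := by gcongr
        _ = _ := by
          have e3 : ∀ z : ℝ, |z| ^ 3 = z ^ 2 * |z| := fun z => by rw [← sq_abs]; ring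
          rw [e3, e3]; ring
    refine hle.trans_eq ?_
    rw [hsix.2]
    rw [integral_prod_mul (fun x : ℤ => |(x : ℝ)| ^ 3) (fun _ : ℤ => (1 : ℝ)),
      integral_prod_mul (fun _ : ℤ => (1 : ℝ)) (fun x : ℤ => |(x : ℝ)| ^ 3),
      integral_prod_mul (fun x : ℤ => |(x : ℝ)|) (fun x : ℤ => (x : ℝ) ^ 2),
      integral_prod_mul (fun x : ℤ => (x : ℝ) ^ 2) (fun x : ℤ => |(x : ℝ)|),
      integral_prod_mul (fun x : ℤ => (x : ℝ) * |(x : ℝ)|) (fun x : ℤ => (x : ℝ)),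
      integral_prod_mul (fun x : ℤ => (x : ℝ)) (fun x : ℤ => (x : ℝ) * |(x : ℝ)|), ← hm]
    simp only [integral_const, probReal_univ, smul_eq_mul]
    change (T * (1 * 1) + 1 * 1 * T + a * b + b * a - 2 * (t * m) - 2 * (m * t)) / 2 = _
    ring
  have hmem : MemLp (fun x : ℤ => (x : ℝ)) 2 ν := (memLp_two_iff_integrable_sq (by fun_prop)).2 i2
  have key := moment_inequality hmem
  have hvar : ∫ x : ℤ, ((x : ℝ) - m) ^ 2 ∂ν = b - m ^ 2 := by
    rw [integral_sub_const_sq i1' i2, ← hm]; ring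
  rw [← hm] at key
  change a * b - 2 * m * t ≤ 2 * √(b - m ^ 2) ^ 3 at key
  rw [hvar]
  linarith

/-- For fixed c the increments of γ(x) - xφ(c) are dominated by those of A q(x - c), where q is
`halfSignedSq`. Hence A q(x - c) ± (γ(x) - xφ(c)) is monotone in x and has nonnegative covariance
with x. Averaging over c with the law itself gives the claim. -/
theorem abs_stein_remainder_le (h3 : Integrable (fun x : ℤ => |(x : ℝ)| ^ 3) ν) {m : ℝ}
    (hm : m = ∫ x : ℤ, (x : ℝ) ∂ν) {γ φ : ℤ → ℝ} {A Mγ Mφ : ℝ} (hMγ : ∀ k, |γ k| ≤ Mγ)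
    (hMφ : ∀ k, |φ k| ≤ Mφ) (hγ : ∀ k, γ (k + 1) - γ k = (φ k + φ (k + 1)) / 2)
    (hφ : ∀ k, |φ (k + 1) - φ k| ≤ A) :
    |∫ x : ℤ, ((x : ℝ) - m) * γ x ∂ν - (∫ x : ℤ, ((x : ℝ) - m) ^ 2 ∂ν) * ∫ c, φ c ∂ν|
      ≤ A * (√(∫ x : ℤ, ((x : ℝ) - m) ^ 2 ∂ν) ^ 3 + (∫ x : ℤ, |(x : ℝ)| ^ 3 ∂ν) / 2) := by
  have hA : 0 ≤ A := (abs_nonneg _).trans (hφ 0)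
  obtain ⟨hI, hle⟩ := integral_integral_halfSignedSq_le h3 hm
  have hlip : ∀ a c : ℤ, |φ a - φ c| ≤ A * |(a : ℝ) - c| := by
    have aux : ∀ (c : ℤ) (d : ℕ), |φ (c + d) - φ c| ≤ A * d := by
      intro c d
      induction d with
      | zero => simp
      | succ d ih =>
        have h1 := hφ (c + d)
        have h2 := abs_sub_le (φ (c + d + 1)) (φ (c + d)) (φ c)
        push_cast
        rw [← add_assoc]
        linarith
    intro a c
    rcases le_total c a with h | h
    · obtain ⟨d, rfl⟩ := Int.le.dest h
      simpa using aux c d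
    · obtain ⟨d, rfl⟩ := Int.le.dest h
      rw [abs_sub_comm, abs_sub_comm (a : ℝ)]
      simpa using aux a d
  have hpow : ∀ j : ℕ, j ≤ 3 → Integrable (fun x : ℤ => |(x : ℝ)| ^ j) ν := fun j hj =>
    integrable_of_cubic_bound h3 1 fun x => by
      rw [abs_of_nonneg (by positivity), one_mul]
      exact pow_le_one_add_cube (abs_nonneg _) hj
  have i1 : Integrable (fun x : ℤ => (x : ℝ)) ν :=
    (hpow 1 (by norm_num)).mono' (by fun_prop) (by simp)
  have i2 : Integrable (fun x : ℤ => (x : ℝ) ^ 2) ν := by simpa using hpow 2 (by norm_num)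
  have ic : Integrable (fun x : ℤ => (x : ℝ) - m) ν := i1.sub (integrable_const m)
  have iγ : Integrable (fun x : ℤ => ((x : ℝ) - m) * γ x) ν :=
    ic.mul_bdd (c := Mγ) (by fun_prop) (Filter.Eventually.of_forall hMγ)
  have ix : Integrable (fun x : ℤ => ((x : ℝ) - m) * x) ν := by
    have : ∀ x : ℤ, ((x : ℝ) - m) * x = (x : ℝ) ^ 2 - m * x := fun x => by ring
    simp only [this]
    exact i2.sub (i1.const_mul m)
  have hxx : ∫ x : ℤ, ((x : ℝ) - m) * x ∂ν = ∫ x : ℤ, ((x : ℝ) - m) ^ 2 ∂ν := by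
    have : ∀ x : ℤ, ((x : ℝ) - m) ^ 2 = ((x : ℝ) - m) * x - m * ((x : ℝ) - m) := fun x => by ring
    simp only [this]
    rw [integral_sub ix (ic.const_mul m), integral_const_mul, integral_sub i1 (integrable_const m),
      ← hm]
    simp
  have iq : ∀ c : ℤ, Integrable (fun x : ℤ => ((x : ℝ) - m) * halfSignedSq (x - c)) ν := by
    intro c
    refine integrable_of_cubic_bound h3 ((1 + |m|) * (1 + (c : ℝ) ^ 2) * 2) fun x => ?_
    rw [abs_mul, abs_halfSignedSq]
    set a := |(x : ℝ)|
    have ha : 0 ≤ a := abs_nonneg _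
    have hm0 := abs_nonneg m
    have e1 : |(x : ℝ) - m| ≤ a + |m| := abs_sub _ _
    have e2 : ((x : ℝ) - c) ^ 2 / 2 ≤ a ^ 2 + (c : ℝ) ^ 2 := by
      have := sq_abs (x : ℝ)
      nlinarith [sq_nonneg ((x : ℝ) + c)]
    have a1 : a ≤ 1 + a ^ 3 := by simpa using pow_le_one_add_cube ha (show 1 ≤ 3 by norm_num)
    have a2 := pow_le_one_add_cube ha (show 2 ≤ 3 by norm_num)
    have a3 := pow_nonneg ha 3
    have c2 := sq_nonneg (c : ℝ)
    calc |(x : ℝ) - m| * (((x : ℝ) - c) ^ 2 / 2) ≤ (a + |m|) * (a ^ 2 + (c : ℝ) ^ 2) := by gcongr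
      _ = a ^ 3 + a * (c : ℝ) ^ 2 + |m| * a ^ 2 + |m| * (c : ℝ) ^ 2 := by ring
      _ ≤ (1 + a ^ 3) + (1 + a ^ 3) * (c : ℝ) ^ 2 + |m| * (1 + a ^ 3)
          + |m| * (c : ℝ) ^ 2 * (1 + a ^ 3) := by
        have : |m| * (c : ℝ) ^ 2 ≤ |m| * (c : ℝ) ^ 2 * (1 + a ^ 3) :=
          le_mul_of_one_le_right (by positivity) (by linarith)
        gcongr
        linarith
      _ = (1 + |m|) * (1 + (c : ℝ) ^ 2) * (1 + a ^ 3) := by ring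
      _ ≤ (1 + |m|) * (1 + (c : ℝ) ^ 2) * 2 * (1 + a ^ 3) := by
        have : 0 ≤ (1 + |m|) * (1 + (c : ℝ) ^ 2) * (1 + a ^ 3) := by positivity
        linarith
  have hmain : ∀ c : ℤ, |∫ x : ℤ, ((x : ℝ) - m) * γ x ∂ν
      - (∫ x : ℤ, ((x : ℝ) - m) ^ 2 ∂ν) * φ c|
      ≤ A * ∫ x : ℤ, ((x : ℝ) - m) * halfSignedSq (x - c) ∂ν := by
    intro c
    have hstep : ∀ x : ℤ, |(γ (x + 1) - ((x + 1 : ℤ) : ℝ) * φ c) - (γ x - x * φ c)|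
        ≤ A * halfSignedSq (((x + 1 : ℤ) : ℝ) - c) - A * halfSignedSq (x - c) := by
      intro x
      have h1 := halfSignedSq_int_succ_sub (x - c)
      have h2 := hlip x c
      have h4 := hlip (x + 1) c
      push_cast at h1 h4 ⊢
      have e : (γ (x + 1) - ((x : ℝ) + 1) * φ c) - (γ x - x * φ c)
          = (φ x - φ c) / 2 + (φ (x + 1) - φ c) / 2 := by
        linear_combination hγ x
      rw [e, ← mul_sub, show (x : ℝ) + 1 - c = x - c + 1 by ring, h1]
      refine (abs_add_le _ _).trans ?_
      rw [abs_div, abs_div, abs_two]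
      rw [show (x : ℝ) + 1 - c = x - c + 1 by ring] at h4
      linarith
    have iψ : Integrable (fun x : ℤ => ((x : ℝ) - m) * (γ x - x * φ c)) ν := by
      have : ∀ x : ℤ, ((x : ℝ) - m) * (γ x - x * φ c)
          = ((x : ℝ) - m) * γ x - ((x : ℝ) - m) * x * φ c := fun x => by ring
      simp only [this]
      exact iγ.sub (ix.mul_const _)
    have eψ : ∫ x : ℤ, ((x : ℝ) - m) * (γ x - x * φ c) ∂ν
        = ∫ x : ℤ, ((x : ℝ) - m) * γ x ∂ν - (∫ x : ℤ, ((x : ℝ) - m) ^ 2 ∂ν) * φ c := by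
      have : ∀ x : ℤ, ((x : ℝ) - m) * (γ x - x * φ c)
          = ((x : ℝ) - m) * γ x - ((x : ℝ) - m) * x * φ c := fun x => by ring
      simp only [this]
      rw [integral_sub iγ (ix.mul_const _), integral_mul_const, hxx]
    have iAq := (iq c).const_mul A
    have hplus := integral_sub_mean_mul_nonneg i1 hm
      (f := fun x : ℤ => A * halfSignedSq (x - c) + (γ x - x * φ c))
      (monotone_int_of_le_succ fun x => by
        have := (abs_le.1 (hstep x)).1; linarith)
      ((iAq.add iψ).congr (Filter.Eventually.of_forall fun x => by simp only [Pi.add_apply]; ring))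
    have hminus := integral_sub_mean_mul_nonneg i1 hm
      (f := fun x : ℤ => A * halfSignedSq (x - c) - (γ x - x * φ c))
      (monotone_int_of_le_succ fun x => by
        have := (abs_le.1 (hstep x)).2; linarith)
      ((iAq.sub iψ).congr (Filter.Eventually.of_forall fun x => by simp only [Pi.sub_apply]; ring))
    have ep : ∀ x : ℤ, ((x : ℝ) - m) * (A * halfSignedSq (x - c) + (γ x - x * φ c))
        = A * (((x : ℝ) - m) * halfSignedSq (x - c)) + ((x : ℝ) - m) * (γ x - x * φ c) :=
      fun x => by ring
    have em : ∀ x : ℤ, ((x : ℝ) - m) * (A * halfSignedSq (x - c) - (γ x - x * φ c))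
        = A * (((x : ℝ) - m) * halfSignedSq (x - c)) - ((x : ℝ) - m) * (γ x - x * φ c) :=
      fun x => by ring
    simp only [ep] at hplus
    simp only [em] at hminus
    rw [integral_add iAq iψ, integral_const_mul, eψ] at hplus
    rw [integral_sub iAq iψ, integral_const_mul, eψ] at hminus
    exact abs_le.2 ⟨by linarith, by linarith⟩
  set v := ∫ x : ℤ, ((x : ℝ) - m) ^ 2 ∂ν
  set Γ := ∫ x : ℤ, ((x : ℝ) - m) * γ x ∂ν
  have iφ : Integrable φ ν := integrable_of_abs_le (by fun_prop) hMφ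
  have e : Γ - v * ∫ c, φ c ∂ν = ∫ c, (Γ - v * φ c) ∂ν := by
    rw [integral_sub (integrable_const _) (iφ.const_mul v), integral_const_mul, integral_const]
    simp
  rw [e]
  calc |∫ c, (Γ - v * φ c) ∂ν| ≤ ∫ c, |Γ - v * φ c| ∂ν := abs_integral_le_integral_abs
    _ ≤ ∫ c : ℤ, A * ∫ x : ℤ, ((x : ℝ) - m) * halfSignedSq (x - c) ∂ν ∂ν :=
      integral_mono ((integrable_const Γ).sub (iφ.const_mul v)).abs (hI.const_mul A) hmain
    _ ≤ _ := by rw [integral_const_mul]; exact mul_le_mul_of_nonneg_left hle hA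

end

/-! ### The Stein equation on the integers. -/

/-- The Stein solution for the indicator of `B`, extended by zero to the integers. -/
noncomputable def intSteinSol (n : ℕ) (B : Set ℤ) (z : ℤ) : ℝ :=
  SymmBinom.steinSol n (fun k => B.indicator 1 (k : ℤ)) z.toNat

/-- The probability of `B` under `Bi(n, 1/2)`. -/
noncomputable def symmBinomMass (n : ℕ) (B : Set ℤ) : ℝ :=
  SymmBinom.partialMean n (fun k => B.indicator 1 (k : ℤ)) (n + 1)

theorem indicator_one_nonneg (B : Set ℤ) (z : ℤ) : (0 : ℝ) ≤ B.indicator 1 z :=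
  Set.indicator_nonneg (fun _ _ => zero_le_one) z

theorem indicator_one_le_one (B : Set ℤ) (z : ℤ) : B.indicator (1 : ℤ → ℝ) z ≤ 1 :=
  Set.indicator_le' (fun _ _ => le_rfl) (fun _ _ => zero_le_one) z

theorem symmBinomMass_mem (n : ℕ) (B : Set ℤ) : 0 ≤ symmBinomMass n B ∧ symmBinomMass n B ≤ 1 :=
  ⟨SymmBinom.partialMean_nonneg (fun _ => indicator_one_nonneg B _) _,
    (SymmBinom.partialMean_le_cdf (fun _ => indicator_one_le_one B _) _).trans_eq
      (SymmBinom.cdf_top n)⟩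

theorem abs_intSteinSol_le (n : ℕ) (B : Set ℤ) (z : ℤ) :
    |intSteinSol n B z| ≤ 2 / √(n + 1) := by
  refine (SymmBinom.abs_steinSol_le (fun _ => indicator_one_nonneg B _)
    (fun _ => indicator_one_le_one B _) (symmBinomWeight_le n) _).trans_eq ?_
  ring

theorem abs_intSteinSol_le_of_singleton {n : ℕ} (hn : 0 < n) (b : ℤ) (z : ℤ) :
    |intSteinSol n {b} z| ≤ 4 / (n + 1) := by
  -- For negative `b` the indicator vanishes on ℕ, so the value 0 of `b.toNat` does no harm.
  refine SymmBinom.abs_steinSol_le_of_subsingleton hn (j := b.toNat)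
    (fun _ => indicator_one_nonneg _ _) (fun _ => indicator_one_le_one _ _) (fun i hi => ?_) _
  refine Set.indicator_of_notMem (fun h => hi ?_) _
  rw [Set.mem_singleton_iff] at h
  omega

theorem abs_zdiff_intSteinSol_le {n : ℕ} (hn : 0 < n) (B : Set ℤ) (z : ℤ) :
    |zdiff (intSteinSol n B) z| ≤ 4 / (n + 1) := by
  rw [zdiff_apply, intSteinSol, intSteinSol]
  rcases le_or_gt 0 z with h | h
  · rw [show (z + 1).toNat = z.toNat + 1 by omega]
    exact SymmBinom.abs_steinSol_succ_sub_le (fun _ => indicator_one_nonneg B _)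
      (fun _ => indicator_one_le_one B _) hn _
  · rw [show (z + 1).toNat = 0 by omega, show z.toNat = 0 by omega, sub_self, abs_zero]
    positivity

/-- The Stein equation on `ℤ`, up to an error supported outside `{0, …, n}`. -/
theorem abs_stein_error_le {n : ℕ} (hn : 0 < n) (B : Set ℤ) (z : ℤ) :
    |B.indicator 1 z - symmBinomMass n B - ((n : ℝ) / 4 * zdiff (intSteinSol n B) z
      - ((z : ℝ) - n / 2) * coinAvg (intSteinSol n B) z)|
      ≤ 4 / (n : ℝ) ^ 2 * ((z : ℝ) - n / 2) ^ 2 := by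
  have hn' : (0 : ℝ) < n := by exact_mod_cast hn
  have hm := symmBinomMass_mem n B
  -- Outside {0, …, n} the Stein operator gives 0, so the error is at most 1, while |z - n/2| ≥ n/2.
  -- Integrated, this is Chebyshev's inequality.
  have hout : (z < 0 ∨ (n : ℤ) < z) → |B.indicator 1 z - symmBinomMass n B - 0|
      ≤ 4 / (n : ℝ) ^ 2 * ((z : ℝ) - n / 2) ^ 2 := by
    intro h
    have h1 : |B.indicator 1 z - symmBinomMass n B - 0| ≤ 1 := by
      have := indicator_one_nonneg B z
      have := indicator_one_le_one B z
      exact abs_le.2 ⟨by linarith, by linarith⟩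
    refine h1.trans ?_
    rw [div_mul_eq_mul_div, le_div_iff₀ (by positivity), one_mul]
    rcases h with h | h
    · have h' : (z : ℝ) ≤ 0 := by exact_mod_cast h.le
      nlinarith
    · have h' : (n : ℝ) ≤ z := by exact_mod_cast h.le
      nlinarith
  rcases lt_or_ge z 0 with h | h
  · have e1 : intSteinSol n B z = 0 := by
      rw [intSteinSol, show z.toNat = 0 by omega, SymmBinom.steinSol_zero]
    have e2 : intSteinSol n B (z + 1) = 0 := by
      rw [intSteinSol, show (z + 1).toNat = 0 by omega, SymmBinom.steinSol_zero]
    simpa [zdiff_apply, coinAvg_apply, e1, e2] using hout (Or.inl h)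
  obtain ⟨k, rfl⟩ := Int.eq_ofNat_of_zero_le h
  rcases lt_or_ge n k with hk | hk
  · have e1 : intSteinSol n B k = 0 := by
      rw [intSteinSol, Int.toNat_natCast, SymmBinom.steinSol_of_gt hk]
    have e2 : intSteinSol n B (k + 1) = 0 := by
      rw [intSteinSol, show ((k : ℤ) + 1).toNat = k + 1 by omega,
        SymmBinom.steinSol_of_gt (by omega)]
    simpa [zdiff_apply, coinAvg_apply, e1, e2] using hout (Or.inr (by exact_mod_cast hk))
  · have e := SymmBinom.steinSol_equation (h := fun k => B.indicator (1 : ℤ → ℝ) (k : ℤ)) hk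
    have e0 : B.indicator 1 (k : ℤ) - symmBinomMass n B
        - ((n : ℝ) / 4 * zdiff (intSteinSol n B) k
        - (((k : ℤ) : ℝ) - n / 2) * coinAvg (intSteinSol n B) k) = 0 := by
      rw [zdiff_apply, coinAvg_apply, intSteinSol, intSteinSol, Int.toNat_natCast,
        show ((k : ℤ) + 1).toNat = k + 1 by omega, symmBinomMass, ← e]
      push_cast; ring
    rw [e0, abs_zero]
    positivity

/-! ### The Stein expansion of the sum. -/

section sums

variable {Ω : Type*} [MeasurableSpace Ω] {P : Measure Ω}

/-- The real-valued version of `thirdMomentTerm`. -/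
noncomputable def realThirdMomentTerm {Ω : Type*} [MeasurableSpace Ω] (P : Measure Ω)
    (X : Ω → ℤ) : ℝ :=
  √(variance (fun ω => (X ω : ℝ)) P) ^ 3 + (∫ ω, |(X ω : ℝ)| ^ 3 ∂P) / 2

theorem realThirdMomentTerm_nonneg (X : Ω → ℤ) : 0 ≤ realThirdMomentTerm P X := by
  have : 0 ≤ ∫ ω, |(X ω : ℝ)| ^ 3 ∂P := integral_nonneg fun ω => by positivity
  unfold realThirdMomentTerm
  positivity

theorem integrable_cube_of_thirdMomentTerm_ne_top {X : Ω → ℤ} (hX : Measurable X)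
    (h : thirdMomentTerm P X ≠ ∞) : Integrable (fun ω => |(X ω : ℝ)| ^ 3) P := by
  refine ⟨by fun_prop, ?_⟩
  rw [HasFiniteIntegral]
  have h2 : ∫⁻ ω, ‖(X ω : ℝ)‖ₑ ^ 3 ∂P ≠ ∞ := by
    intro hc
    apply h
    rw [thirdMomentTerm, hc, ENNReal.mul_top (by simp), add_top]
  refine lt_of_le_of_lt (lintegral_mono fun ω => ?_) h2.lt_top
  simp [enorm_pow]

theorem thirdMomentTerm_eq {X : Ω → ℤ} (h : Integrable (fun ω => |(X ω : ℝ)| ^ 3) P) :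
    thirdMomentTerm P X = ENNReal.ofReal (realThirdMomentTerm P X) := by
  have h0 : 0 ≤ ∫ ω, |(X ω : ℝ)| ^ 3 ∂P := integral_nonneg fun ω => by positivity
  have e : ∫⁻ ω, ‖(X ω : ℝ)‖ₑ ^ 3 ∂P = ENNReal.ofReal (∫ ω, |(X ω : ℝ)| ^ 3 ∂P) := by
    rw [ofReal_integral_eq_lintegral_ofReal h (Filter.Eventually.of_forall fun ω => by positivity)]
    refine lintegral_congr fun ω => ?_
    rw [ENNReal.ofReal_pow (abs_nonneg _), Real.enorm_eq_ofReal_abs]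
  rw [thirdMomentTerm, realThirdMomentTerm, e, ENNReal.ofReal_add (by positivity) (by positivity),
    div_eq_inv_mul, ENNReal.ofReal_mul (by norm_num), ENNReal.ofReal_inv_of_pos two_pos]
  simp

theorem variance_eq_integral_map {X : Ω → ℤ} (hX : Measurable X) :
    variance (fun ω => (X ω : ℝ)) P
      = ∫ x : ℤ, ((x : ℝ) - ∫ x : ℤ, (x : ℝ) ∂(P.map X)) ^ 2 ∂(P.map X) := by
  rw [variance_eq_integral (by fun_prop), integral_map hX.aemeasurable (by fun_prop),
    integral_map hX.aemeasurable (by fun_prop)]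

variable {J : Type*} [Fintype J] {ξ : J → Ω → ℤ}

theorem variance_intCast_sum (hvar : ∀ i, MemLp (fun ω => (ξ i ω : ℝ)) 2 P)
    (hind : iIndepFun ξ P) : variance (fun ω => ((∑ i, ξ i ω : ℤ) : ℝ)) P
      = ∑ i, variance (fun ω => (ξ i ω : ℝ)) P := by
  have := IndepFun.variance_sum (μ := P) (s := Finset.univ) (X := fun i ω => (ξ i ω : ℝ))
    (fun i _ => hvar i) (fun i _ j _ hij => (hind.indepFun hij).comp
      (φ := fun x : ℤ => (x : ℝ)) (ψ := fun x : ℤ => (x : ℝ)) (by fun_prop) (by fun_prop))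
  rw [← this]
  congr 1
  ext ω; simp

variable [IsProbabilityMeasure P]

/-- One summand of the Stein expansion. -/
theorem abs_stein_summand_le {X Z : Ω → ℤ} (hX : Measurable X) (hZ : Measurable Z)
    (hind : IndepFun X Z P) (h3 : Integrable (fun ω => |(X ω : ℝ)| ^ 3) P) {g : ℤ → ℝ} {M A : ℝ}
    (hM : ∀ k, |g k| ≤ M) (hA : ∀ y, |∫ ω, zdiff (zdiff g) (y + Z ω) ∂P| ≤ A) (s : ℤ) :
    |∫ ω, ((X ω : ℝ) - ∫ ω, (X ω : ℝ) ∂P) * coinAvg g (X ω + Z ω - s) ∂P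
      - variance (fun ω => (X ω : ℝ)) P * ∫ ω, zdiff g (X ω + Z ω - s) ∂P|
      ≤ A * realThirdMomentTerm P X := by
  have hprob : IsProbabilityMeasure (P.map X) := Measure.isProbabilityMeasure_map hX.aemeasurable
  have hΘ : ∀ k, |coinAvg g k| ≤ M := fun k => by simpa using abs_coinAvg_pow_le 1 hM k
  have hΔ := abs_zdiff_le hM
  have h3' : Integrable (fun x : ℤ => |(x : ℝ)| ^ 3) (P.map X) :=
    (integrable_map_measure (by fun_prop) hX.aemeasurable).2 h3
  have iX : Integrable (fun ω => (X ω : ℝ)) P := by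
    have : Integrable (fun x : ℤ => (x : ℝ)) (P.map X) :=
      integrable_of_cubic_bound h3' 1 fun x => by
        simpa using pow_le_one_add_cube (abs_nonneg (x : ℝ)) (show 1 ≤ 3 by norm_num)
    exact (integrable_map_measure (by fun_prop) hX.aemeasurable).1 this
  have hmean : ∫ x : ℤ, (x : ℝ) ∂(P.map X) = ∫ ω, (X ω : ℝ) ∂P :=
    integral_map hX.aemeasurable (by fun_prop)
  set m := ∫ ω, (X ω : ℝ) ∂P
  have bint : ∀ {f : ℤ → ℝ} {C : ℝ}, (∀ k, |f k| ≤ C) → ∀ y : ℤ,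
      Integrable (fun ω => f (y + Z ω - s)) P := fun hf y =>
    integrable_of_abs_le (by fun_prop) fun ω => hf _
  have babs : ∀ {f : ℤ → ℝ} {C : ℝ}, (∀ k, |f k| ≤ C) → ∀ y : ℤ,
      |∫ ω, f (y + Z ω - s) ∂P| ≤ C := by
    intro f C hf y
    have := norm_integral_le_of_norm_le_const (μ := P) (f := fun ω => f (y + Z ω - s)) (C := C)
      (Filter.Eventually.of_forall fun ω => hf _)
    simpa using this
  have e1 := integral_comp_indepFun hX hZ hind
    (fun x z => ((x : ℝ) - m) * coinAvg g (x + z - s))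
    ((iX.sub (integrable_const m)).mul_bdd (c := M) (by fun_prop)
      (Filter.Eventually.of_forall fun ω => hΘ _))
  have e2 := integral_comp_indepFun hX hZ hind (fun x z => zdiff g (x + z - s))
    (integrable_of_abs_le (by fun_prop) fun ω => hΔ _)
  -- γ and φ are Θg and Δg averaged over the other summands; the identity Δ(Θg) = Θ(Δg) survives
  -- averaging.
  have key := abs_stein_remainder_le h3' hmean.symm
    (γ := fun x => ∫ ω, coinAvg g (x + Z ω - s) ∂P) (φ := fun x => ∫ ω, zdiff g (x + Z ω - s) ∂P)
    (A := A) (babs hΘ) (babs hΔ) (fun k => by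
      rw [← integral_sub (bint hΘ _) (bint hΘ _), ← integral_add (bint hΔ _) (bint hΔ _),
        ← integral_div]
      refine integral_congr_ae (Filter.Eventually.of_forall fun ω => ?_)
      simp only [coinAvg_apply, zdiff_apply]
      rw [show k + 1 + Z ω - s = k + Z ω - s + 1 by ring]
      ring) (fun k => by
      rw [← integral_sub (bint hΔ _) (bint hΔ _)]
      refine le_trans (le_of_eq ?_) (hA (k - s))
      congr 1
      refine integral_congr_ae (Filter.Eventually.of_forall fun ω => ?_)
      change _ = zdiff g (k - s + Z ω + 1) - zdiff g (k - s + Z ω)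
      rw [show k - s + Z ω + 1 = k + 1 + Z ω - s by ring,
        show k - s + Z ω = k + Z ω - s by ring])
  simp only [integral_const_mul] at e1
  rw [e1, e2, realThirdMomentTerm, variance_eq_integral_map hX, hmean]
  rw [integral_map hX.aemeasurable (f := fun x : ℤ => |(x : ℝ)| ^ 3) (by fun_prop)] at key
  exact key

/-- The Stein expansion of the centred sum. -/
theorem abs_stein_sum_le (hmeas : ∀ i, Measurable (ξ i)) (hind : iIndepFun ξ P)
    (hvar : ∀ i, MemLp (fun ω => (ξ i ω : ℝ)) 2 P)
    (h3 : ∀ i, Integrable (fun ω => |(ξ i ω : ℝ)| ^ 3) P) {g : ℤ → ℝ} {M A : ℝ}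
    (hM : ∀ k, |g k| ≤ M) [DecidableEq J]
    (hA : ∀ i y, |∫ ω, zdiff (zdiff g) (y + ∑ j ∈ Finset.univ.erase i, ξ j ω) ∂P| ≤ A) (s : ℤ) :
    |∫ ω, (((∑ i, ξ i ω : ℤ) : ℝ) - ∫ ω, ((∑ i, ξ i ω : ℤ) : ℝ) ∂P)
        * coinAvg g (∑ i, ξ i ω - s) ∂P
      - variance (fun ω => ((∑ i, ξ i ω : ℤ) : ℝ)) P * ∫ ω, zdiff g (∑ i, ξ i ω - s) ∂P|
      ≤ A * ∑ i, realThirdMomentTerm P (ξ i) := by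
  have i1 : ∀ i, Integrable (fun ω => (ξ i ω : ℝ)) P := fun i => (hvar i).integrable one_le_two
  have hΘ : ∀ k, |coinAvg g k| ≤ M := fun k => by simpa using abs_coinAvg_pow_le 1 hM k
  have hWm : Measurable fun ω => ∑ i, ξ i ω := Finset.measurable_sum _ fun i _ => hmeas i
  have hv := variance_intCast_sum hvar hind
  have hmean : ∫ ω, ((∑ i, ξ i ω : ℤ) : ℝ) ∂P = ∑ i, ∫ ω, (ξ i ω : ℝ) ∂P := by
    rw [← integral_finsetSum _ fun i _ => i1 i]
    simp
  have hprod : ∫ ω, (((∑ i, ξ i ω : ℤ) : ℝ) - ∫ ω, ((∑ i, ξ i ω : ℤ) : ℝ) ∂P)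
        * coinAvg g (∑ i, ξ i ω - s) ∂P
      = ∑ i, ∫ ω, ((ξ i ω : ℝ) - ∫ ω, (ξ i ω : ℝ) ∂P) * coinAvg g (∑ i, ξ i ω - s) ∂P := by
    have iprod : ∀ i, Integrable (fun ω => ((ξ i ω : ℝ) - ∫ ω, (ξ i ω : ℝ) ∂P)
        * coinAvg g (∑ j, ξ j ω - s)) P := fun i =>
      ((i1 i).sub (integrable_const _)).mul_bdd (c := M) (by fun_prop)
        (Filter.Eventually.of_forall fun ω => hΘ _)
    rw [← integral_finsetSum _ fun i _ => iprod i, hmean]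
    refine integral_congr_ae (Filter.Eventually.of_forall fun ω => ?_)
    simp only [← Finset.sum_mul, Finset.sum_sub_distrib]
    push_cast
    rfl
  rw [hprod, hv, Finset.sum_mul, ← Finset.sum_sub_distrib, Finset.mul_sum]
  refine (Finset.abs_sum_le_sum_abs _ _).trans (Finset.sum_le_sum fun i _ => ?_)
  have hsplit : ∀ ω, ∑ j, ξ j ω = ξ i ω + ∑ j ∈ Finset.univ.erase i, ξ j ω := fun ω =>
    (Finset.add_sum_erase _ _ (Finset.mem_univ i)).symm
  have hZ : Measurable fun ω => ∑ j ∈ Finset.univ.erase i, ξ j ω :=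
    Finset.measurable_sum _ fun i _ => hmeas i
  have hiZ : IndepFun (ξ i) (fun ω => ∑ j ∈ Finset.univ.erase i, ξ j ω) P := by
    have := (hind.indepFun_finsetSum_of_notMem hmeas (Finset.notMem_erase i Finset.univ)).symm
    convert this using 1
    ext ω; simp
  simp only [hsplit]
  exact abs_stein_summand_le (hmeas i) hZ hiZ (h3 i) hM (hA i) s

/-- The approximation error of a single event, in terms of bounds for the Stein solution. -/
theorem abs_integral_indicator_sub_mass_le (hmeas : ∀ i, Measurable (ξ i)) (hind : iIndepFun ξ P)
    (hvar : ∀ i, MemLp (fun ω => (ξ i ω : ℝ)) 2 P)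
    (h3 : ∀ i, Integrable (fun ω => |(ξ i ω : ℝ)| ^ 3) P) {μ σ : ℝ}
    (hμ : μ = ∫ ω, ((∑ i, ξ i ω : ℤ) : ℝ) ∂P) (hσ0 : 0 < σ)
    (hσ : variance (fun ω => ((∑ i, ξ i ω : ℤ) : ℝ)) P = σ ^ 2)
    {n : ℕ} (hn : n = ⌈4 * σ ^ 2⌉₊) {s : ℤ} (hs : s = ⌈μ - (n : ℝ) / 2⌉) [DecidableEq J]
    (B : Set ℤ) {M D A : ℝ} (hM : ∀ k, |intSteinSol n B k| ≤ M)
    (hD : ∀ k, |zdiff (intSteinSol n B) k| ≤ D)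
    (hA : ∀ i y, |∫ ω, zdiff (zdiff (intSteinSol n B))
      (y + ∑ j ∈ Finset.univ.erase i, ξ j ω) ∂P| ≤ A) :
    |∫ ω, B.indicator 1 (∑ i, ξ i ω - s) ∂P - symmBinomMass n B|
      ≤ A * ∑ i, realThirdMomentTerm P (ξ i) + M + D / 4 + (σ ^ 2 + 1) / (4 * σ ^ 4) := by
  have hWm : Measurable fun ω => ∑ i, ξ i ω := Finset.measurable_sum _ fun i _ => hmeas i
  set W : Ω → ℤ := fun ω => ∑ i, ξ i ω with hW
  have hM0 : 0 ≤ M := (abs_nonneg _).trans (hM 0)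
  have hD0 : 0 ≤ D := (abs_nonneg _).trans (hD 0)
  have hn1 : 4 * σ ^ 2 ≤ n := hn ▸ Nat.le_ceil _
  have hn2 : (n : ℝ) < 4 * σ ^ 2 + 1 := hn ▸ Nat.ceil_lt_add_one (by positivity)
  have hnpos : (0 : ℝ) < n := lt_of_lt_of_le (by positivity) hn1
  have hn0 : 0 < n := by exact_mod_cast hnpos
  -- The error in matching the means; the ceiling in `s` puts it in [0, 1].
  set t : ℝ := s + n / 2 - μ with ht
  have ht0 : 0 ≤ t := by have := Int.le_ceil (μ - (n : ℝ) / 2); rw [← hs] at this; linarith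
  have ht1 : t ≤ 1 := by have := Int.ceil_lt_add_one (μ - (n : ℝ) / 2); rw [← hs] at this; linarith
  have hWL : MemLp (fun ω => (W ω : ℝ)) 2 P := by
    have := memLp_finsetSum Finset.univ fun i _ => hvar i
    refine this.congr_norm (by fun_prop) (Filter.Eventually.of_forall fun ω => by simp [hW])
  have iW : Integrable (fun ω => (W ω : ℝ)) P := hWL.integrable one_le_two
  have iW2 : Integrable (fun ω => (W ω : ℝ) ^ 2) P := hWL.integrable_sq
  set g := intSteinSol n B
  have hΘ : ∀ k, |coinAvg g k| ≤ M := fun k => by simpa using abs_coinAvg_pow_le 1 hM k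
  have iΘ : Integrable (fun ω => coinAvg g (W ω - s)) P :=
    integrable_of_abs_le (by fun_prop) fun ω => hΘ _
  have iΔ : Integrable (fun ω => zdiff g (W ω - s)) P :=
    integrable_of_abs_le (by fun_prop) fun ω => hD _
  have iWΘ : Integrable (fun ω => ((W ω : ℝ) - μ) * coinAvg g (W ω - s)) P :=
    (iW.sub (integrable_const _)).mul_bdd (c := M) (by fun_prop)
      (Filter.Eventually.of_forall fun ω => hΘ _)
  have iB : Integrable (fun ω => B.indicator (1 : ℤ → ℝ) (W ω - s)) P :=
    integrable_of_abs_le (M := 1) (by fun_prop) fun ω => by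
      rw [abs_of_nonneg (indicator_one_nonneg B _)]; exact indicator_one_le_one B _
  have bΘ : |∫ ω, coinAvg g (W ω - s) ∂P| ≤ M := by
    simpa using norm_integral_le_of_norm_le_const (μ := P) (f := fun ω => coinAvg g (W ω - s))
      (Filter.Eventually.of_forall fun ω => hΘ _)
  have bΔ : |∫ ω, zdiff g (W ω - s) ∂P| ≤ D := by
    simpa using norm_integral_le_of_norm_le_const (μ := P) (f := fun ω => zdiff g (W ω - s))
      (Filter.Eventually.of_forall fun ω => hD _)
  have hmain := abs_stein_sum_le hmeas hind hvar h3 hM hA s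
  rw [← hμ, hσ] at hmain
  change |∫ ω, ((W ω : ℝ) - μ) * coinAvg g (W ω - s) ∂P - σ ^ 2 * ∫ ω, zdiff g (W ω - s) ∂P|
    ≤ _ at hmain
  set R : Ω → ℝ := fun ω => B.indicator 1 (W ω - s) - symmBinomMass n B
    - ((n : ℝ) / 4 * zdiff g (W ω - s)
      - (((W ω : ℝ) - μ) * coinAvg g (W ω - s) - t * coinAvg g (W ω - s))) with hR
  have iin : Integrable (fun ω => ((W ω : ℝ) - μ) * coinAvg g (W ω - s)
      - t * coinAvg g (W ω - s)) P := iWΘ.sub (iΘ.const_mul t)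
  have iL : Integrable (fun ω => (n : ℝ) / 4 * zdiff g (W ω - s)
      - (((W ω : ℝ) - μ) * coinAvg g (W ω - s) - t * coinAvg g (W ω - s))) P :=
    (iΔ.const_mul _).sub iin
  have iBm : Integrable (fun ω => B.indicator (1 : ℤ → ℝ) (W ω - s) - symmBinomMass n B) P :=
    iB.sub (integrable_const _)
  have eR : ∫ ω, R ω ∂P = ∫ ω, B.indicator 1 (W ω - s) ∂P - symmBinomMass n B
      - ((n : ℝ) / 4 * ∫ ω, zdiff g (W ω - s) ∂P - (∫ ω, ((W ω : ℝ) - μ) * coinAvg g (W ω - s) ∂P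
        - t * ∫ ω, coinAvg g (W ω - s) ∂P)) := by
    rw [hR, integral_sub iBm iL, integral_sub iB (integrable_const _),
      integral_sub (iΔ.const_mul _) iin, integral_sub iWΘ (iΘ.const_mul t), integral_const_mul,
      integral_const_mul, integral_const]
    simp
  have isq : Integrable (fun ω => ((W ω : ℝ) - (s + n / 2)) ^ 2) P :=
    (hWL.sub (memLp_const _)).integrable_sq
  have bR : |∫ ω, R ω ∂P| ≤ 4 / (n : ℝ) ^ 2 * (σ ^ 2 + t ^ 2) := by
    have e2 : ∫ ω, ((W ω : ℝ) - (s + n / 2)) ^ 2 ∂P = σ ^ 2 + t ^ 2 := by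
      rw [integral_sub_const_sq iW iW2, ← hσ, variance_eq_sub hWL]
      simp only [Pi.pow_apply]
      rw [← hμ, ht]; ring
    rw [← e2, ← integral_const_mul]
    rw [← Real.norm_eq_abs]
    refine norm_integral_le_of_norm_le (isq.const_mul _) (Filter.Eventually.of_forall fun ω => ?_)
    have := abs_stein_error_le hn0 B (W ω - s)
    rw [Real.norm_eq_abs]
    convert this using 2
    · simp only [hR, ht]; push_cast; ring
    · push_cast; ring
  -- Here n ≥ 4σ² and t ≤ 1.
  have bR' : 4 / (n : ℝ) ^ 2 * (σ ^ 2 + t ^ 2) ≤ (σ ^ 2 + 1) / (4 * σ ^ 4) := by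
    have h1 : 4 / (n : ℝ) ^ 2 ≤ 1 / (4 * σ ^ 4) := by
      rw [div_le_div_iff₀ (by positivity) (by positivity)]
      nlinarith [sq_nonneg σ]
    have h2 : t ^ 2 ≤ 1 := by nlinarith
    calc 4 / (n : ℝ) ^ 2 * (σ ^ 2 + t ^ 2) ≤ 1 / (4 * σ ^ 4) * (σ ^ 2 + 1) := by gcongr
      _ = _ := by ring
  -- The four terms are the Stein expansion, the mismatch of means, the mismatch n/4 - σ² of
  -- variances (at most 1/4), and the mass outside {0, …, n}.
  have hfin : ∫ ω, B.indicator 1 (W ω - s) ∂P - symmBinomMass n B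
      = -(∫ ω, ((W ω : ℝ) - μ) * coinAvg g (W ω - s) ∂P - σ ^ 2 * ∫ ω, zdiff g (W ω - s) ∂P)
        + t * (∫ ω, coinAvg g (W ω - s) ∂P)
        + ((n : ℝ) / 4 - σ ^ 2) * (∫ ω, zdiff g (W ω - s) ∂P) + ∫ ω, R ω ∂P := by
    rw [eR]; ring
  rw [hfin]
  have b2 : |t * ∫ ω, coinAvg g (W ω - s) ∂P| ≤ M := by
    rw [abs_mul, abs_of_nonneg ht0]
    exact (mul_le_of_le_one_left (abs_nonneg _) ht1).trans bΘ
  have b3 : |((n : ℝ) / 4 - σ ^ 2) * ∫ ω, zdiff g (W ω - s) ∂P| ≤ D / 4 := by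
    rw [abs_mul, abs_of_nonneg (by linarith)]
    calc ((n : ℝ) / 4 - σ ^ 2) * |∫ ω, zdiff g (W ω - s) ∂P| ≤ 1 / 4 * D := by
          gcongr; linarith
      _ = _ := by ring
  refine (abs_add_le _ _).trans (add_le_add ((abs_add_le _ _).trans (add_le_add
    ((abs_add_le _ _).trans (add_le_add ?_ b2)) b3)) (bR.trans bR'))
  rwa [abs_neg]

end sums

/-! ### From Borel sets to sets of integers, and the two bounds. -/

theorem indicator_one_congr {α β : Type*} {S : Set α} {T : Set β} {a : α} {b : β}
    (h : a ∈ S ↔ b ∈ T) : S.indicator (1 : α → ℝ) a = T.indicator (1 : β → ℝ) b := by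
  by_cases ha : a ∈ S
  · simp [ha, h.1 ha]
  · simp [ha, mt h.2 ha]

theorem binomial_half_measureReal (n : ℕ) (hp : (1 / 2 : ℝ) ∈ unitInterval) (C : Set ℕ) :
    (binomial n ⟨1 / 2, hp⟩).real C
      = ∑ k ∈ Finset.range (n + 1), symmBinomWeight n k * C.indicator 1 k := by
  have hw : ∀ k ∈ Finset.range (n + 1),
      (binomial n ⟨1 / 2, hp⟩).real {k} = symmBinomWeight n k := by
    intro k hk
    have hk' : k ≤ n := Nat.lt_succ_iff.1 (Finset.mem_range.1 hk)
    rw [binomial_real_singleton, symmBinomWeight]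
    simp only
    rw [mul_assoc, show (1 : ℝ) - 1 / 2 = 1 / 2 by norm_num, ← pow_add, Nat.add_sub_cancel' hk',
      one_div, inv_pow, div_eq_mul_inv]
  have hC : MeasurableSet C := .of_discrete
  have hi : Integrable (C.indicator (1 : ℕ → ℝ)) (binomial n ⟨1 / 2, hp⟩) :=
    (integrable_const (1 : ℝ)).indicator hC
  rw [← integral_indicator_one hC, integral_countable hi,
    tsum_eq_sum (s := Finset.range (n + 1))]
  · exact Finset.sum_congr rfl fun k hk => by rw [hw k hk, smul_eq_mul]
  · intro k hk
    rw [binomial_real_singleton, Nat.choose_eq_zero_of_lt (by simpa using hk)]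
    simp

theorem shiftedSymmBinomial_measureReal (n : ℕ) (s : ℤ) {A : Set ℝ} (hA : MeasurableSet A) :
    (shiftedSymmBinomial n s).real A = symmBinomMass n {z : ℤ | ((z + s : ℤ) : ℝ) ∈ A} := by
  rw [shiftedSymmBinomial, Measure.conv_dirac, map_measureReal_apply (by fun_prop) hA,
    map_measureReal_apply (by fun_prop) (hA.preimage (by fun_prop))]
  refine (binomial_half_measureReal n _ _).trans ?_
  rw [symmBinomMass, SymmBinom.partialMean]
  refine Finset.sum_congr rfl fun k _ => ?_
  congr 1
  exact indicator_one_congr (by simp)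

theorem intLaw_measureReal {Ω : Type*} [MeasurableSpace Ω] (P : Measure Ω)
    {W : Ω → ℤ} (hW : Measurable W) (s : ℤ) {A : Set ℝ} (hA : MeasurableSet A) :
    (intLaw P W).real A
      = ∫ ω, {z : ℤ | ((z + s : ℤ) : ℝ) ∈ A}.indicator 1 (W ω - s) ∂P := by
  rw [intLaw, map_measureReal_apply (by fun_prop) hA,
    ← integral_indicator_one (hA.preimage (by fun_prop))]
  congr 1
  ext ω
  exact indicator_one_congr (by simp)

theorem dTV_le_one (μ ν : Measure ℝ) [IsProbabilityMeasure μ] [IsProbabilityMeasure ν] :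
    dTV μ ν ≤ 1 := by
  have : Nonempty {A : Set ℝ // MeasurableSet A} := ⟨⟨∅, .empty⟩⟩
  refine ciSup_le fun A => ?_
  have h1 : μ.real A ≤ 1 := measureReal_le_one
  have h2 : ν.real A ≤ 1 := measureReal_le_one
  have h3 : 0 ≤ μ.real A := measureReal_nonneg
  have h4 : 0 ≤ ν.real A := measureReal_nonneg
  exact abs_le.2 ⟨by linarith, by linarith⟩

theorem smoothness_nonneg {Ω : Type*} [MeasurableSpace Ω] (P : Measure Ω)
    [IsProbabilityMeasure P] {X : Ω → ℤ} (hX : Measurable X) : 0 ≤ smoothness P X := by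
  have : IsProbabilityMeasure (intLaw P X) :=
    Measure.isProbabilityMeasure_map (by fun_prop)
  have : IsProbabilityMeasure (intLaw P fun ω => X ω + 1) :=
    Measure.isProbabilityMeasure_map (by fun_prop)
  have := dTV_le_one (intLaw P X) (intLaw P fun ω => X ω + 1)
  exact le_min (by norm_num) (by linarith)

theorem corollary2p3 {Ω : Type*} [MeasurableSpace Ω] (P : Measure Ω) [IsProbabilityMeasure P]
    {J : Type*} [Fintype J] (ξ : J → Ω → ℤ) (hmeas : ∀ i, Measurable (ξ i))
    (hvar : ∀ i, MemLp (fun ω => (ξ i ω : ℝ)) 2 P) (hind : iIndepFun ξ P)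
    (W : Ω → ℤ) (hW : W = fun ω => ∑ i, ξ i ω)
    (μ : ℝ) (hμ : μ = ∫ ω, (W ω : ℝ) ∂P)
    (σ : ℝ) (hσ : σ = √(variance (fun ω => (W ω : ℝ)) P)) (hσ1 : 1 < σ ^ 2)
    (V : ℝ) (hV : V = ∑ i, smoothness P (ξ i))
    (vmax : ℝ) (hvmax : vmax = ⨆ i, smoothness P (ξ i))
    (n : ℕ) (hn : n = ⌈4 * σ ^ 2⌉₊) (s : ℤ) (hs : s = ⌈μ - (n : ℝ) / 2⌉) :
    ENNReal.ofReal (dTV (intLaw P W) (shiftedSymmBinomial n s)) ≤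
        2 * (∑ i, thirdMomentTerm P (ξ i)) /
            (ENNReal.ofReal (σ ^ 2) * ENNReal.ofReal (V - vmax) ^ (1 / 2 : ℝ))
          + ENNReal.ofReal ((1 + 2.25 * σ⁻¹ + 0.25 * (σ ^ 2)⁻¹) / σ) ∧
    ENNReal.ofReal (dLoc (intLaw P W) (shiftedSymmBinomial n s)) ≤
        8 * (∑ i, thirdMomentTerm P (ξ i)) /
            (ENNReal.ofReal (σ ^ 2) * ENNReal.ofReal (V - 4 * vmax))
          + ENNReal.ofReal ((3.25 + 0.25 * σ⁻¹) / σ ^ 2) := by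
  classical
  subst hW
  have hσnn : 0 ≤ σ := hσ ▸ Real.sqrt_nonneg _
  have hσgt : 1 < σ := by nlinarith
  have hσ0 : 0 < σ := by linarith
  have hσ2 : variance (fun ω => ((∑ i, ξ i ω : ℤ) : ℝ)) P = σ ^ 2 := by
    rw [hσ, Real.sq_sqrt (variance_nonneg _ _)]
  have hvsum : σ ^ 2 = ∑ i, variance (fun ω => (ξ i ω : ℝ)) P := by
    rw [← hσ2, ← variance_intCast_sum hvar hind]
  have hWm : Measurable fun ω => ∑ i, ξ i ω := Finset.measurable_sum _ fun i _ => hmeas i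
  by_cases htop : ∑ i, thirdMomentTerm P (ξ i) = ∞
  · rw [htop, ENNReal.mul_top (by norm_num), ENNReal.mul_top (by norm_num),
      ENNReal.top_div_of_ne_top, ENNReal.top_div_of_ne_top]
    · simp
    · exact ENNReal.mul_ne_top ENNReal.ofReal_ne_top ENNReal.ofReal_ne_top
    · exact ENNReal.mul_ne_top ENNReal.ofReal_ne_top
        (ENNReal.rpow_ne_top_of_nonneg (by norm_num) ENNReal.ofReal_ne_top)
  have h3 : ∀ i, Integrable (fun ω => |(ξ i ω : ℝ)| ^ 3) P := fun i =>
    integrable_cube_of_thirdMomentTerm_ne_top (hmeas i) fun h =>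
      htop (ENNReal.sum_eq_top.2 ⟨i, Finset.mem_univ i, h⟩)
  set τ := ∑ i, realThirdMomentTerm P (ξ i) with hτ
  have hτeq : ∑ i, thirdMomentTerm P (ξ i) = ENNReal.ofReal τ := by
    rw [hτ, ENNReal.ofReal_sum_of_nonneg fun i _ => realThirdMomentTerm_nonneg _]
    exact Finset.sum_congr rfl fun i _ => thirdMomentTerm_eq (h3 i)
  -- Positivity is needed because 0/0 = 0 in `ℝ≥0∞`: it makes the right-hand side infinite when the
  -- denominator vanishes.
  have hτ0 : 0 < τ := by
    obtain ⟨i, -, hi⟩ : ∃ i ∈ Finset.univ, 0 < variance (fun ω => (ξ i ω : ℝ)) P :=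
      Finset.exists_lt_of_sum_lt (f := fun _ : J => (0 : ℝ)) (by
        rw [Finset.sum_const_zero, ← hvsum]; linarith)
    refine Finset.sum_pos' (fun i _ => realThirdMomentTerm_nonneg _) ⟨i, Finset.mem_univ i, ?_⟩
    have h1 : 0 ≤ ∫ ω, |(ξ i ω : ℝ)| ^ 3 ∂P := integral_nonneg fun ω => by positivity
    have h2 := pow_pos (Real.sqrt_pos.2 hi) 3
    unfold realThirdMomentTerm
    linarith
  have hv0 : ∀ i, 0 ≤ smoothness P (ξ i) := fun i => smoothness_nonneg P (hmeas i)
  have hvmax0 : 0 ≤ vmax := hvmax ▸ Real.iSup_nonneg hv0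
  have hU : ∀ i, V - vmax ≤ ∑ j ∈ Finset.univ.erase i, shiftOverlap (P.map (ξ j)) := by
    intro i
    have h1 : smoothness P (ξ i) ≤ vmax :=
      hvmax ▸ le_ciSup (f := fun i => smoothness P (ξ i)) (Set.finite_range _).bddAbove i
    have h2 : V = smoothness P (ξ i) + ∑ j ∈ Finset.univ.erase i, smoothness P (ξ j) := by
      rw [hV, Finset.add_sum_erase _ (fun j => smoothness P (ξ j)) (Finset.mem_univ i)]
    have h3 := Finset.sum_le_sum fun j (_ : j ∈ Finset.univ.erase i) =>
      smoothness_le_shiftOverlap P (hmeas j)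
    linarith
  have hn1 : 4 * σ ^ 2 ≤ n := hn ▸ Nat.le_ceil _
  have hnpos : 0 < n := by
    have : (0 : ℝ) < n := lt_of_lt_of_le (by positivity) hn1
    exact_mod_cast this
  have hD : (4 : ℝ) / (n + 1) ≤ 1 / σ ^ 2 := by
    rw [div_le_div_iff₀ (by positivity) (by positivity)]; linarith
  have hM : (2 : ℝ) / √(n + 1) ≤ 1 / σ := by
    have h1 : 2 * σ ≤ √(n + 1) := Real.le_sqrt_of_sq_le (by nlinarith)
    rw [div_le_div_iff₀ (by positivity) hσ0]; linarith
  have hinv0 : 0 < σ⁻¹ := inv_pos.2 hσ0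
  have hinv1 : σ⁻¹ ≤ 1 := inv_le_one_of_one_le₀ hσgt.le
  constructor
  · rcases le_or_gt (V - vmax) 0 with hneg | hpos
    · rw [ENNReal.ofReal_of_nonpos hneg, ENNReal.zero_rpow_of_pos (by norm_num), mul_zero,
        ENNReal.div_zero (by rw [hτeq]; simp [hτ0])]
      simp
    have hsq : 0 < √(V - vmax) := Real.sqrt_pos.2 hpos
    rw [hτeq, ENNReal.ofReal_rpow_of_pos hpos, ← Real.sqrt_eq_rpow,
      ← ENNReal.ofReal_mul (by positivity), ← ENNReal.ofReal_ofNat 2,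
      ← ENNReal.ofReal_mul (by positivity), ← ENNReal.ofReal_div_of_pos (by positivity),
      ← ENNReal.ofReal_add (by positivity) (by positivity)]
    refine ENNReal.ofReal_le_ofReal ?_
    have : Nonempty {A : Set ℝ // MeasurableSet A} := ⟨⟨∅, .empty⟩⟩
    refine ciSup_le fun A => ?_
    rw [intLaw_measureReal P hWm s A.2, shiftedSymmBinomial_measureReal n s A.2]
    have h := abs_integral_indicator_sub_mass_le hmeas hind hvar h3 hμ hσ0 hσ2 hn hs
      {z : ℤ | ((z + s : ℤ) : ℝ) ∈ A.1} (M := 1 / σ) (D := 1 / σ ^ 2) (A := 2 * (1 / σ ^ 2) / √(V - vmax))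
      (fun k => (abs_intSteinSol_le n _ k).trans hM)
      (fun k => (abs_zdiff_intSteinSol_le hnpos _ k).trans hD)
      (fun i y => abs_integral_zdiff_le hmeas hind
        (fun k => (abs_zdiff_intSteinSol_le hnpos _ k).trans hD) _ hpos (hU i) y)
    refine h.trans ?_
    have e1 : 2 * (1 / σ ^ 2) / √(V - vmax) * τ = 2 * τ / (σ ^ 2 * √(V - vmax)) := by
      field_simp
    have e2 : 1 / σ + 1 / σ ^ 2 / 4 + (σ ^ 2 + 1) / (4 * σ ^ 4)
        = σ⁻¹ + 0.5 * σ⁻¹ ^ 2 + 0.25 * σ⁻¹ ^ 4 := by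
      field_simp; ring
    have e3 : (1 + 2.25 * σ⁻¹ + 0.25 * (σ ^ 2)⁻¹) / σ
        = σ⁻¹ + 2.25 * σ⁻¹ ^ 2 + 0.25 * σ⁻¹ ^ 3 := by
      field_simp
    -- The sum of the error terms is σ⁻¹ + σ⁻²/2 + σ⁻⁴/4, so the claimed constants leave room.
    have e4 : σ⁻¹ ^ 4 ≤ σ⁻¹ ^ 3 := pow_le_pow_of_le_one hinv0.le hinv1 (by norm_num)
    rw [e3, ← hτ, e1]
    have := sq_nonneg σ⁻¹
    linarith
  · rcases le_or_gt (V - 4 * vmax) 0 with hneg | hpos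
    · rw [ENNReal.ofReal_of_nonpos hneg, mul_zero, ENNReal.div_zero (by rw [hτeq]; simp [hτ0])]
      simp
    rw [hτeq, ← ENNReal.ofReal_mul (by positivity), ← ENNReal.ofReal_ofNat 8,
      ← ENNReal.ofReal_mul (by positivity), ← ENNReal.ofReal_div_of_pos (by positivity),
      ← ENNReal.ofReal_add (by positivity) (by positivity)]
    refine ENNReal.ofReal_le_ofReal (ciSup_le fun x => ?_)
    -- A half-open unit interval contains exactly one integer, so only point indicators occur and
    -- the sharper bound of order 1/n for the Stein solution is available.
    have hB : {z : ℤ | ((z + s : ℤ) : ℝ) ∈ Set.Ico x (x + 1)} = {⌈x⌉ - s} := by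
      ext z
      simp only [Set.mem_ofPred_eq, Set.mem_Ico, Set.mem_singleton_iff]
      rw [eq_sub_iff_add_eq, eq_comm, Int.ceil_eq_iff]
      constructor <;> rintro ⟨h1, h2⟩ <;> constructor <;> linarith
    rw [intLaw_measureReal P hWm s measurableSet_Ico,
      shiftedSymmBinomial_measureReal n s measurableSet_Ico, hB]
    have h := abs_integral_indicator_sub_mass_le hmeas hind hvar h3 hμ hσ0 hσ2 hn hs
      {⌈x⌉ - s} (M := 1 / σ ^ 2) (D := 1 / σ ^ 2)
      (A := 8 * (1 / σ ^ 2) / (V - 4 * vmax))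
      (fun k => (abs_intSteinSol_le_of_singleton hnpos _ k).trans hD)
      (fun k => (abs_zdiff_intSteinSol_le hnpos _ k).trans hD)
      -- Both differences are moved onto the sum, so only ‖g‖ enters. The argument works with V -
      -- v*, and V - 4v* is no larger because v* ≥ 0.
      (fun i y => abs_integral_zdiff_zdiff_le hmeas hind
        (fun k => (abs_intSteinSol_le_of_singleton hnpos _ k).trans hD) _ hpos
        (le_trans (by linarith) (hU i)) y)
    refine h.trans ?_
    have e1 : 8 * (1 / σ ^ 2) / (V - 4 * vmax) * τ = 8 * τ / (σ ^ 2 * (V - 4 * vmax)) := by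
      field_simp
    have e2 : 1 / σ ^ 2 + 1 / σ ^ 2 / 4 + (σ ^ 2 + 1) / (4 * σ ^ 4)
        = 1.5 * σ⁻¹ ^ 2 + 0.25 * σ⁻¹ ^ 4 := by
      field_simp; ring
    have e3 : (3.25 + 0.25 * σ⁻¹) / σ ^ 2 = 3.25 * σ⁻¹ ^ 2 + 0.25 * σ⁻¹ ^ 3 := by
      field_simp
    have e4 : σ⁻¹ ^ 4 ≤ σ⁻¹ ^ 3 := pow_le_pow_of_le_one hinv0.le hinv1 (by norm_num)
    rw [e3, ← hτ, e1]
    have := sq_nonneg σ⁻¹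
    linarith
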